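/- All words are finite or one-sided infinite words over the alphabet $\mathbb{N}=\{0,1,2,\dots\}$, with positions numbered from $0$; $\varepsilon$ is the empty word. A word is square-free if it has no factor $yy$ with $y\neq\varepsilon$. For a finite word $w$, $L(w)$ denotes the lexicographically least infinite word beginning with $w$ in which every occurrence of a square is contained in the prefix $w$; for an infinite word $w$, $L(w)=w$. A word $w$ is even-grounded if $w_i=0$ for all even $i$ and $w_i\neq 0$ for all odd $i$. Let $\Sigma$ be the set of all nonempty even-grounded square-free words (finite or infinite). Notation: $w[:-k]$ is $w$ without its last $k$ letters, $w[-k:]$ is the suffix of $w$ of length $k$, $w[a:-k]$ is $w$ without its first $a$ and last $k$ letters, and $w^+$ is the nonempty finite word $w$ with its last letter increased by $1$. Let $\rho$ be the morphism $\rho(n)=0\,(n+1)$ and $R_n=\rho^n(0)$; the ruler sequence is $\rho^\infty(0)=0102010301020104\cdots$. For $n\ge 0$ let $P_0(n)$ be the longest prefix of the ruler sequence such that $n\,P_0(n)$ is a prefix of $L(n)$. Define the morphism $\psi_1$ by $\psi_1(0)=202101$ and $\psi_1(n)=(n+1)\,P_0(n+1)$ for $n>0$; for $n\ge 3$ let $P_1(n)=\psi_1(P_0(n-1))$;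 and define the morphism $\psi_2$ by $\psi_2(n)=(n+2)\,P_0(n+2)\,P_1(n+2)$ for $n>0$ and \begin{align*} \psi_2(0)={}&2021020102101201020120210120102013010201030102012021012010201\\ &2021013010201030102012021012010201202301020103010201202101201\\ &0201203010201030102030103020102030102010301020301030201202101\\ &2010201202101202. \end{align*} Let \begin{align*} C&=0102030102,\\ B_0&=0301\;\psi_1(1010)[:-3]\;\psi_2(1010)[:-6]\;\psi_2(10)[:-12]\;301020,\\ B_1&=\rho(B_0[7:-5]),\\ E&=0102\cdot B_0\cdot 1\cdot B_0[:-9],\\ F&=B_0[-9:]\;3010302\;C\;0103\;C^+\;02,\\ G&=010203012, \end{align*} and let $\alpha$ be the morphism with \[\alpha(0)=EFE,\qquad \alpha(1)=B_1\,R_4\,C\,B_1\,R_4,\qquad \alpha(n)=\alpha(n-1)^+\,R_{n+3}\,C\,\alpha(n-1)^+\,R_{n+3}\quad(n\ge 2).\] Then $\alpha$ is $L$-commuting over $\Sigma$, that is, $L(\alpha(w))=\alpha(L(w))$ for all $w\in\Sigma$. Moreover, $L(G)=L(\alpha(0))=\alpha(L(\varepsilon))$. -/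

import Mathlib

namespace LexSquareFree

/-- A word over the alphabet `ℕ`: finite or (one-sided) infinite. -/
inductive Word where
  | fin (w : List ℕ) : Word
  | inf (s : ℕ → ℕ) : Word

namespace Word

/-- The letter of a word at position `i` (positions start at `0`), if there is one. -/
def get? : Word → ℕ → Option ℕ
  | fin w, i => w[i]?
  | inf s, i => some (s i)

/-- The finite word `v` occurs in the word `u` at position `i`. -/
def OccursAt (v : List ℕ) (u : Word) (i : ℕ) : Prop :=
  ∀ j < v.length, u.get? (i + j) = v[j]?

/-- No nonempty word of the form `yy` occurs in `u`. -/
def SquareFree (u : Word) : Prop :=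
  ∀ (y : List ℕ) (i : ℕ), y ≠ [] → ¬ OccursAt (y ++ y) u i

/-- Letters at even positions are zero and letters at odd positions are nonzero. -/
def EvenGrounded (u : Word) : Prop :=
  ∀ i a, u.get? i = some a → (Even i → a = 0) ∧ (Odd i → a ≠ 0)

/-- The lexicographic relation `u ≺ v`. -/
def LexLT (u v : Word) : Prop :=
  ∃ i, (∀ j < i, u.get? j = v.get? j) ∧
    ∃ a b, u.get? i = some a ∧ v.get? i = some b ∧ a < b

end Word

open Word

/-- The infinite word `s` begins with `p`, and every square occurring in `s` lies inside
the prefix `p`. -/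
def IsCompletion (p : List ℕ) (s : ℕ → ℕ) : Prop :=
  OccursAt p (inf s) 0 ∧
    ∀ (y : List ℕ) (i : ℕ), y ≠ [] → OccursAt (y ++ y) (inf s) i →
      i + (y ++ y).length ≤ p.length

/-- `s` is the lexicographically least completion of `p`. -/
def IsLeastCompletion (p : List ℕ) (s : ℕ → ℕ) : Prop :=
  IsCompletion p s ∧ ∀ t, IsCompletion p t → t = s ∨ LexLT (inf s) (inf t)

theorem occursAt_inf_congr {v : List ℕ} {s t : ℕ → ℕ} {i : ℕ}
    (h : ∀ j < i + v.length, s j = t j) (hs : OccursAt v (inf s) i) :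
    OccursAt v (inf t) i := by
  intro j hj
  have h1 := hs j hj
  simp only [Word.get?] at h1 ⊢
  rw [← h (i + j) (by omega)]
  exact h1

theorem exists_isCompletion (p : List ℕ) : ∃ s, IsCompletion p s := by
  refine ⟨fun i => if h : i < p.length then p[i] else p.sum + 1 + i, ?_, ?_⟩
  · intro j hj
    simp [Word.get?, hj]
  · intro y i hy hocc
    by_contra hlt
    have hpos : 0 < y.length := List.length_pos_iff.mpr hy
    rw [List.length_append] at hlt
    have h1 := hocc (y.length - 1) (by rw [List.length_append]; omega)
    have h2 := hocc (y.length + (y.length - 1)) (by rw [List.length_append]; omega)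
    rw [List.getElem?_append_left (by omega)] at h1
    rw [List.getElem?_append_right (by omega), Nat.add_sub_cancel_left, ← h1] at h2
    simp only [Word.get?, Option.some.injEq] at h2
    rw [dif_neg (by omega)] at h2
    split_ifs at h2 with h3
    · have := List.single_le_sum (l := p) (by simp) _ (List.getElem_mem h3)
      omega
    · omega

/-- Every finite word has a lexicographically least completion. -/
theorem exists_isLeastCompletion (p : List ℕ) : ∃ s, IsLeastCompletion p s := by
  classical
  have step : ∀ (k : ℕ) (s : {s // IsCompletion p s}), ∃ t : {t // IsCompletion p t},
      (∀ j < k, t.1 j = s.1 j) ∧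
      ∀ r, IsCompletion p r → (∀ j < k, r j = s.1 j) → t.1 k ≤ r k := by
    intro k s
    have hne : ∃ a, ∃ r, IsCompletion p r ∧ (∀ j < k, r j = s.1 j) ∧ r k = a :=
      ⟨_, s.1, s.2, fun _ _ => rfl, rfl⟩
    obtain ⟨r, hr, hr1, hr2⟩ := Nat.find_spec hne
    refine ⟨⟨r, hr⟩, hr1, fun q hq hq1 => ?_⟩
    change r k ≤ q k
    rw [hr2]
    exact Nat.find_min' hne ⟨q, hq, hq1, rfl⟩
  choose next hnext hmin using step
  obtain ⟨s₀, hs₀⟩ := exists_isCompletion p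
  let f : ℕ → {s // IsCompletion p s} := fun n => Nat.rec ⟨s₀, hs₀⟩ (fun k s => next k s) n
  have hf : ∀ k, f (k + 1) = next k (f k) := fun _ => rfl
  have agree : ∀ k d j, j < k → (f (k + d)).1 j = (f k).1 j := by
    intro k d j hj
    induction d with
    | zero => rfl
    | succ d ih => rw [← Nat.add_assoc, hf, hnext _ _ j (by omega), ih]
  let u : ℕ → ℕ := fun k => (f (k + 1)).1 k
  have hu : ∀ k j, j < k → (f k).1 j = u j := by
    intro k j hj
    obtain ⟨d, rfl⟩ := Nat.exists_eq_add_of_le (Nat.succ_le_of_lt hj)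
    exact agree (j + 1) d j (by omega)
  refine ⟨u, ⟨?_, ?_⟩, ?_⟩
  · exact occursAt_inf_congr (fun j hj => hu (0 + p.length) j hj) (f (0 + p.length)).2.1
  · intro y i hy hocc
    exact (f (i + (y ++ y).length)).2.2 y i hy
      (occursAt_inf_congr (fun j hj => (hu _ j hj).symm) hocc)
  · intro t ht
    by_cases hne : t = u
    · exact Or.inl hne
    · right
      have hex : ∃ k, t k ≠ u k := by
        by_contra hcon
        push Not at hcon
        exact hne (funext hcon)
      have hlow : ∀ j < Nat.find hex, t j = u j := fun j hj => by
        have := Nat.find_min hex hj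
        push Not at this
        exact this
      refine ⟨Nat.find hex, fun j hj => ?_, u (Nat.find hex), t (Nat.find hex), rfl, rfl, ?_⟩
      · simp [Word.get?, hlow j hj]
      · refine lt_of_le_of_ne ?_ (Ne.symm (Nat.find_spec hex))
        exact hmin (Nat.find hex) (f (Nat.find hex)) t ht
          (fun j hj => by rw [hlow j hj, hu _ j hj])

/-- `L w`: for finite `w`, the lexicographically least infinite word that begins with `w` and
whose only square factors are contained in the prefix `w`; for infinite `w`, the word `w`. -/
noncomputable def L : Word → Word
  | fin p => inf (Classical.choose (exists_isLeastCompletion p))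
  | inf s => inf s

/-- The image of a finite word under the morphism with letter images `φ`. -/
def mapList (φ : ℕ → List ℕ) (w : List ℕ) : List ℕ := w.flatMap φ

/-- The prefix of length `k` of an infinite word. -/
def takeInf (s : ℕ → ℕ) (k : ℕ) : List ℕ := (List.range k).map s

theorem exists_lt_length_mapList (φ : ℕ → List ℕ) (s : ℕ → ℕ)
    (h : ¬ ∃ k, ∀ j, k ≤ j → φ (s j) = []) (i : ℕ) :
    ∃ k, i < (mapList φ (takeInf s k)).length := by
  have succ_len : ∀ k, (mapList φ (takeInf s (k + 1))).length =
      (mapList φ (takeInf s k)).length + (φ (s k)).length := by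
    intro k
    simp [mapList, takeInf, List.range_succ, List.flatMap_append]
  have mono : Monotone fun k => (mapList φ (takeInf s k)).length :=
    monotone_nat_of_le_succ fun k => by rw [succ_len]; omega
  push Not at h
  induction i with
  | zero =>
    obtain ⟨j, -, hj⟩ := h 0
    have := List.length_pos_iff.mpr hj
    exact ⟨j + 1, by rw [succ_len]; omega⟩
  | succ i ih =>
    obtain ⟨k, hk⟩ := ih
    obtain ⟨j, hkj, hj⟩ := h k
    have := List.length_pos_iff.mpr hj
    have h2 : (mapList φ (takeInf s k)).length ≤ (mapList φ (takeInf s j)).length := mono hkj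
    exact ⟨j + 1, by rw [succ_len]; omega⟩

open Classical in
/-- The image of a finite or infinite word under the morphism with letter images `φ`, that is,
the concatenation of the images of its letters. The image of an infinite word is finite exactly
when all but finitely many of its letters are erased. -/
noncomputable def applyMorphism (φ : ℕ → List ℕ) : Word → Word
  | fin w => fin (mapList φ w)
  | inf s =>
    if h : ∃ k, ∀ j, k ≤ j → φ (s j) = [] then
      fin (mapList φ (takeInf s h.choose))
    else
      inf fun i => (mapList φ (takeInf s (Nat.find (exists_lt_length_mapList φ s h i))))[i]'
        (Nat.find_spec (exists_lt_length_mapList φ s h i))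

/-- The morphism `φ` commutes with `L` on all words of `Δ`. -/
def LCommuting (φ : ℕ → List ℕ) (Δ : Set Word) : Prop :=
  ∀ w ∈ Δ, L (applyMorphism φ w) = applyMorphism φ (L w)

/-- The set `Σ` of nonempty even-grounded square-free words (finite or infinite). -/
def SigmaWords : Set Word := {w | w ≠ fin [] ∧ w.EvenGrounded ∧ w.SquareFree}

/-- The ruler morphism. -/
def rho (n : ℕ) : List ℕ := [0, n + 1]

/-- The word `R n = ρⁿ(0)`. -/
def R (n : ℕ) : List ℕ := (mapList rho)^[n] [0]

/-- The ruler sequence: the infinite word that has every `R n`, a word of length `2 ^ n`,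
as a prefix. -/
def ruler (i : ℕ) : ℕ := (R i).getD i 0

/-- The successor `w⁺` of a nonempty word: its last letter is increased by one. -/
def plus (w : List ℕ) : List ℕ := w.dropLast ++ [w.getLastD 0 + 1]

/-- The longest prefix `P₀` of the ruler sequence such that `n P₀` is a prefix of `L(n)`. -/
noncomputable def P0 (n : ℕ) : List ℕ :=
  takeInf ruler (sSup {m : ℕ | OccursAt (n :: takeInf ruler m) (L (fin [n])) 0})

noncomputable def psi1 : ℕ → List ℕ
  | 0 => [2, 0, 2, 1, 0, 1]
  | n + 1 => (n + 2) :: P0 (n + 2)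

/-- Used for `n ≥ 3` only. -/
noncomputable def P1 (n : ℕ) : List ℕ := mapList psi1 (P0 (n - 1))

noncomputable def psi2 : ℕ → List ℕ
  | 0 =>
    [
      2, 0, 2, 1, 0, 2, 0, 1, 0, 2, 1, 0, 1, 2, 0, 1, 0, 2, 0, 1, 2, 0, 2, 1, 0,
      1, 2, 0, 1, 0, 2, 0, 1, 3, 0, 1, 0, 2, 0, 1, 0, 3, 0, 1, 0, 2, 0, 1, 2, 0,
      2, 1, 0, 1, 2, 0, 1, 0, 2, 0, 1, 2, 0, 2, 1, 0, 1, 3, 0, 1, 0, 2, 0, 1, 0,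
      3, 0, 1, 0, 2, 0, 1, 2, 0, 2, 1, 0, 1, 2, 0, 1, 0, 2, 0, 1, 2, 0, 2, 3, 0,
      1, 0, 2, 0, 1, 0, 3, 0, 1, 0, 2, 0, 1, 2, 0, 2, 1, 0, 1, 2, 0, 1, 0, 2, 0,
      1, 2, 0, 3, 0, 1, 0, 2, 0, 1, 0, 3, 0, 1, 0, 2, 0, 3, 0, 1, 0, 3, 0, 2, 0,
      1, 0, 2, 0, 3, 0, 1, 0, 2, 0, 1, 0, 3, 0, 1, 0, 2, 0, 3, 0, 1, 0, 3, 0, 2,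
      0, 1, 2, 0, 2, 1, 0, 1, 2, 0, 1, 0, 2, 0, 1, 2, 0, 2, 1, 0, 1, 2, 0, 2]
  | n + 1 => (n + 3) :: (P0 (n + 3) ++ P1 (n + 3))

def C : List ℕ := [0, 1, 0, 2, 0, 3, 0, 1, 0, 2]

/-- Here `List.rdrop w k` is `w` without its last `k` letters, and `List.rtake w k` is the
suffix of `w` of length `k`. -/
noncomputable def B0 : List ℕ :=
  [0, 3, 0, 1] ++ (mapList psi1 [1, 0, 1, 0]).rdrop 3 ++ (mapList psi2 [1, 0, 1, 0]).rdrop 6 ++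
    (mapList psi2 [1, 0]).rdrop 12 ++ [3, 0, 1, 0, 2, 0]

noncomputable def B1 : List ℕ := mapList rho ((B0.drop 7).rdrop 5)

noncomputable def E : List ℕ := [0, 1, 0, 2] ++ B0 ++ [1] ++ B0.rdrop 9

noncomputable def F : List ℕ :=
  B0.rtake 9 ++ [3, 0, 1, 0, 3, 0, 2] ++ C ++ [0, 1, 0, 3] ++ plus C ++ [0, 2]

def G : List ℕ := [0, 1, 0, 2, 0, 3, 0, 1, 2]

/-- The letter images of the morphism `α`. -/
noncomputable def alpha : ℕ → List ℕ
  | 0 => E ++ F ++ E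
  | 1 => B1 ++ R 4 ++ C ++ B1 ++ R 4
  | n + 2 => plus (alpha (n + 1)) ++ R (n + 5) ++ C ++ plus (alpha (n + 1)) ++ R (n + 5)

end LexSquareFree

/-!
Every finite word over `ℕ` can be extended by a new letter without completing a square. Hence the
least completion of a word is the greedy one: each further letter is the least letter that completes
no square, and `s` is the least completion of `p` if and only if `s` is a completion of `p` and, from
the end of `p` on, every letter smaller than the letter of `s` would complete a square
(`isLeastCompletion_iff`). If `w` is even-grounded and square-free, then so is `u = L w`. So two
facts have to be shown: the product of the words `alpha (u k)` is square-free, and its letters beyond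
the image of `w` are greedy.

Square-freeness is proved twice by the same argument (`Separated.isSq_cases`). Consider a product of
blocks `D γ(u₀) D γ(u₁) ⋯` with an even-grounded sequence `u`, where the letters of `D` and `γ(0)` are
smaller than `ℓ`, while `γ(n)` with `n ≠ 0` contains larger letters. If the period of a square carries
a large letter to another block, it also carries a copy of `D` to a copy of `D`, and since the words
`γ(n)` form a prefix code with distinct last letters, the square comes from a square in `u`
(`IsSq.exists_isSq_of_aligned`). Otherwise the square lies in a single `γ(n)`, except for a few letters
on both sides. All that remains is that the word between two large letters is square-free, and this
is a finite computation.

* With `D = E`, `γ(0) = F` and `γ(n) = alpha n`, the product is the product of the words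
  `alpha (u k)`, because `alpha 0 = E F E`. It remains to show that `2 · alpha n · 01020301` is
  square-free for `n ≠ 0` (`sqFree_alpha`).
* The word `C · alpha n` is the product of the blocks `C B1 · q j`, where `j` runs through the letters
  of `R (n - 1) R (n - 1)`, and `q j` is `R (j + 4) R (j + 4)` without the first 16 letters. So the
  argument applies with `D = C B1` and `γ = q`. The square of `R (n - 1)` is not an obstacle, since
  `2 · alpha n · 01020301` is one letter shorter than its image. What remains are factors
  of the infinite repetition of `R K`; these have no squares of period less than `2 ^ K`, by
  comparing exponents of `2` (`not_isSq_cap`).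

For greediness, nearly all letters of `E F E B1` and of `C B1` are forced by letters of these very
words, which is checked by computation, and the words `R k` are forced everywhere (`forced_R`). The
other letters are the first `3` of `C` and of `E`, where `1` would complete a square of period
`2 ^ (j + 4)` around `q j` (`blocked_one`), the `2` at position 8 of `E`, where `0` would complete a
square since `alpha n` has the form `A C A` (`blocked_zero`), and the last letters of the words
`alpha m` for `m < n` inside of `alpha n`. Such a last letter has to be raised, because it would
complete either the square `C alpha m` (`blocked_after_C`) or the image of the square that
shows that `m` is not the greedy choice in `u` (`forced_alpha_of_greedy`).
-/

namespace LexSquareFree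

open Word

/-! ### Squares and least completions -/

/-- The factor of length `2 * p` of `s` at position `i` is a square. -/
def IsSq (s : ℕ → ℕ) (i p : ℕ) : Prop := 0 < p ∧ ∀ a < p, s (i + a) = s (i + p + a)

/-- Appending the letter `c` to the finite word `w` completes a square. -/
def Blocked (w : List ℕ) (c : ℕ) : Prop := ∃ y : List ℕ, y ≠ [] ∧ y ++ y <:+ w ++ [c]

theorem occursAt_inf_iff {v : List ℕ} {s : ℕ → ℕ} {i : ℕ} :
    OccursAt v (inf s) i ↔ ∀ j (h : j < v.length), s (i + j) = v[j] := by
  constructor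
  · intro h j hj
    have := h j hj
    simpa [Word.get?, List.getElem?_eq_getElem hj] using this
  · intro h j hj
    simp [Word.get?, h j hj]

@[simp] theorem length_takeInf (s : ℕ → ℕ) (k : ℕ) : (takeInf s k).length = k := by
  simp [takeInf]

@[simp] theorem getElem_takeInf (s : ℕ → ℕ) (k j : ℕ) (h : j < (takeInf s k).length) :
    (takeInf s k)[j] = s j := by
  simp [takeInf]

theorem takeInf_succ (s : ℕ → ℕ) (k : ℕ) : takeInf s (k + 1) = takeInf s k ++ [s k] := by
  simp [takeInf, List.range_succ]

theorem takeInf_add (s : ℕ → ℕ) (m n : ℕ) :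
    takeInf s (m + n) = takeInf s m ++ takeInf (fun j => s (m + j)) n := by
  simp [takeInf, List.range_add, Function.comp_def]

theorem takeInf_congr {s t : ℕ → ℕ} {k : ℕ} (h : ∀ j < k, s j = t j) :
    takeInf s k = takeInf t k :=
  List.map_congr_left fun j hj => h j (List.mem_range.mp hj)

theorem IsSq.congr {s t : ℕ → ℕ} {i p i' : ℕ} (h : IsSq s i p)
    (hst : ∀ a < 2 * p, s (i + a) = t (i' + a)) : IsSq t i' p := by
  refine ⟨h.1, fun a ha => ?_⟩
  rw [← hst a (by omega), h.2 a ha, Nat.add_assoc i, hst (p + a) (by omega), Nat.add_assoc i']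

theorem isSq_of_occursAt {s : ℕ → ℕ} {y : List ℕ} {i : ℕ} (hy : y ≠ [])
    (h : OccursAt (y ++ y) (inf s) i) : IsSq s i y.length := by
  rw [occursAt_inf_iff] at h
  refine ⟨List.length_pos_iff.mpr hy, fun a ha => ?_⟩
  have h1 := h a (by simp; omega)
  have h2 := h (y.length + a) (by simp; omega)
  rw [List.getElem_append_left ha] at h1
  rw [List.getElem_append_right (by omega)] at h2
  simp only [Nat.add_sub_cancel_left] at h2
  rw [h1, Nat.add_assoc, h2]

theorem IsSq.exists_occursAt {s : ℕ → ℕ} {i p : ℕ} (h : IsSq s i p) :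
    ∃ y : List ℕ, y ≠ [] ∧ y.length = p ∧ OccursAt (y ++ y) (inf s) i := by
  have hlen := length_takeInf (fun j => s (i + j)) p
  refine ⟨takeInf (fun j => s (i + j)) p, ?_, hlen, ?_⟩
  · rw [← List.length_pos_iff, hlen]; exact h.1
  · rw [occursAt_inf_iff]
    intro j hj
    rw [List.length_append, hlen] at hj
    rcases Nat.lt_or_ge j p with h1 | h1
    · rw [List.getElem_append_left (by omega)]; simp
    · rw [List.getElem_append_right (by omega)]
      simp only [hlen, getElem_takeInf]
      rw [h.2 (j - p) (by omega)]
      congr 1; omega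

theorem isCompletion_iff {p : List ℕ} {s : ℕ → ℕ} :
    IsCompletion p s ↔
      takeInf s p.length = p ∧ ∀ i q, IsSq s i q → i + 2 * q ≤ p.length := by
  have h0 : OccursAt p (inf s) 0 ↔ takeInf s p.length = p := by
    rw [occursAt_inf_iff]
    constructor
    · intro h
      exact List.ext_getElem (by simp) fun j h1 h2 => by simpa using h j h2
    · intro h j hj
      have : (takeInf s p.length)[j]'(by simpa using hj) = p[j] := by simp only [h]
      simpa using this
  unfold IsCompletion
  rw [h0]
  refine and_congr_right fun _ => ⟨fun h i q hq => ?_, fun h y i hy ho => ?_⟩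
  · obtain ⟨y, hy, hl, ho⟩ := hq.exists_occursAt
    have := h y i hy ho
    rw [List.length_append] at this
    omega
  · have := h _ _ (isSq_of_occursAt hy ho)
    rw [List.length_append]
    omega

theorem blocked_takeInf_iff {t : ℕ → ℕ} {j : ℕ} :
    Blocked (takeInf t j) (t j) ↔ ∃ i p, IsSq t i p ∧ i + 2 * p = j + 1 := by
  unfold Blocked
  rw [← takeInf_succ]
  constructor
  · rintro ⟨y, hy, z, hz⟩
    have hl := congrArg List.length hz
    simp only [List.length_append, length_takeInf] at hl
    refine ⟨z.length, y.length, isSq_of_occursAt hy ?_, by omega⟩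
    rw [occursAt_inf_iff]
    intro a ha
    rw [List.length_append] at ha
    have h1 : (takeInf t (j + 1))[z.length + a]'(by simp; omega) = t (z.length + a) := by simp
    rw [← h1]
    simp only [← hz]
    rw [List.getElem_append_right (by omega)]
    simp
  · rintro ⟨i, p, hs, hij⟩
    refine ⟨takeInf (fun a => t (i + a)) p, ?_, takeInf t i, ?_⟩
    · rw [← List.length_pos_iff, length_takeInf]; exact hs.1
    · rw [← hij, show i + 2 * p = i + (p + p) by omega, takeInf_add, takeInf_add]
      congr 2
      exact takeInf_congr fun a ha => by rw [hs.2 a ha, Nat.add_assoc]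

theorem Blocked.append_left {w : List ℕ} {c : ℕ} (h : Blocked w c) (z : List ℕ) :
    Blocked (z ++ w) c := by
  obtain ⟨y, hy, hs⟩ := h
  exact ⟨y, hy, by rw [List.append_assoc]; exact hs.trans (List.suffix_append _ _)⟩

/-- A least completion is a completion chosen greedily: every smaller letter would complete a
square. A letter exceeding all letters of a finite word never completes a square, so the greedy
choice never has to be revised. -/
theorem isLeastCompletion_iff {p : List ℕ} {s : ℕ → ℕ} :
    IsLeastCompletion p s ↔
      IsCompletion p s ∧ ∀ j, p.length ≤ j → ∀ c < s j, Blocked (takeInf s j) c := by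
  refine and_congr_right fun hs => ⟨fun h j hj c hc => ?_, fun h t ht => ?_⟩
  · by_contra hb
    -- The competitor copies `s` before `j`, has `c` at `j`, and pairwise distinct new letters after.
    let M := (takeInf s j).sum + c + 1
    let t : ℕ → ℕ := fun i => if i < j then s i else if i = j then c else M + i
    have hlow : ∀ i < j, t i = s i := fun i hi => by simp [t, hi]
    have htj : t j = c := by simp [t]
    have hbig : ∀ i, j < i → t i = M + i := fun i hi => by
      simp [t, show ¬ i < j by omega, show i ≠ j by omega]
    have hsmall : ∀ i ≤ j, t i < M := by
      intro i hi
      rcases Nat.lt_or_eq_of_le hi with h1 | rfl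
      · rw [hlow i h1]
        have : s i ≤ (takeInf s j).sum := by
          refine List.single_le_sum (by simp) _ ?_
          simp only [takeInf, List.mem_map, List.mem_range]
          exact ⟨i, h1, rfl⟩
        simp only [M]; omega
      · rw [htj]; simp only [M]; omega
    have htake : takeInf t j = takeInf s j := takeInf_congr hlow
    have hcomp : IsCompletion p t := by
      rw [isCompletion_iff] at hs ⊢
      refine ⟨?_, fun i q hq => ?_⟩
      · rw [← hs.1, length_takeInf]
        exact takeInf_congr fun i hi => hlow i (by omega)
      · have hqp := hq.1
        rcases Nat.lt_trichotomy (i + 2 * q) (j + 1) with h1 | h1 | h1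
        · exact hs.2 i q (hq.congr fun a ha => hlow _ (by omega))
        · refine absurd ?_ hb
          rw [← htake, ← htj, blocked_takeInf_iff]
          exact ⟨i, q, hq, h1⟩
        · have h2 := hq.2 (q - 1) (by omega)
          rw [hbig (i + q + (q - 1)) (by omega)] at h2
          rcases Nat.lt_or_ge j (i + (q - 1)) with h3 | h3
          · rw [hbig _ h3] at h2; omega
          · have := hsmall _ h3; omega
    rcases h t hcomp with h1 | ⟨i, hi, a, b, ha, hb', hab⟩
    · rw [h1] at htj; omega
    · simp only [Word.get?, Option.some.injEq] at hi ha hb'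
      rcases Nat.lt_trichotomy i j with h1 | rfl | h1
      · have := hlow i h1; omega
      · omega
      · have := hi j h1; omega
  · by_cases hne : t = s
    · exact Or.inl hne
    · right
      have hex : ∃ k, t k ≠ s k := by
        by_contra hcon
        push Not at hcon
        exact hne (funext hcon)
      classical
      have hlow : ∀ j < Nat.find hex, t j = s j := fun j hj => by
        have := Nat.find_min hex hj
        push Not at this
        exact this
      have hk := Nat.find_spec hex
      refine ⟨Nat.find hex, fun j hj => by simp [Word.get?, hlow j hj],
        s (Nat.find hex), t (Nat.find hex), rfl, rfl, ?_⟩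
      generalize Nat.find hex = k at hlow hk
      rw [isCompletion_iff] at hs ht
      have hpk : p.length ≤ k := by
        by_contra hlt
        push Not at hlt
        have : (takeInf t p.length)[k]'(by simpa) = (takeInf s p.length)[k]'(by simpa) := by
          simp only [ht.1, hs.1]
        simp only [getElem_takeInf] at this
        exact hk this
      by_contra hle
      have hb := h k hpk (t k) (by omega)
      rw [← takeInf_congr hlow, blocked_takeInf_iff] at hb
      obtain ⟨i, q, hq, hiq⟩ := hb
      have := ht.2 i q hq
      omega

theorem IsLeastCompletion.L_eq {p : List ℕ} {s : ℕ → ℕ} (h : IsLeastCompletion p s) :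
    L (fin p) = inf s := by
  have h2 := Classical.choose_spec (exists_isLeastCompletion p)
  change inf (Classical.choose (exists_isLeastCompletion p)) = inf s
  generalize Classical.choose (exists_isLeastCompletion p) = t at h2
  rcases h.2 t h2.1 with h3 | ⟨i, hi, a, b, ha, hb, hab⟩
  · rw [h3]
  rcases h2.2 s h.1 with h4 | ⟨i', hi', a', b', ha', hb', hab'⟩
  · rw [h4]
  simp only [Word.get?, Option.some.injEq] at *
  rcases Nat.lt_trichotomy i i' with h5 | rfl | h5
  · have := hi' i h5; omega
  · omega
  · have := hi i' h5; omega

/-! ### Forced letters -/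

/-- Every letter of `z`, read after the finite word `w`, is forced by greedy minimality: all
smaller letters complete a square. -/
def Forced (w z : List ℕ) : Prop :=
  ∀ o (h : o < z.length), ∀ c < z[o], Blocked (w ++ z.take o) c

theorem forced_append {w x y : List ℕ} :
    Forced w (x ++ y) ↔ Forced w x ∧ Forced (w ++ x) y := by
  constructor
  · intro h
    refine ⟨fun o ho c hc => ?_, fun o ho c hc => ?_⟩
    · have := h o (by simp; omega) c (by rwa [List.getElem_append_left ho])
      rwa [List.take_append_of_le_length (by omega)] at this
    · have := h (x.length + o) (by simp; omega) c
        (by rw [List.getElem_append_right (by omega)]; simpa using hc)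
      rwa [List.take_length_add_append, ← List.append_assoc] at this
  · rintro ⟨h1, h2⟩ o ho c hc
    rw [List.length_append] at ho
    rcases Nat.lt_or_ge o x.length with h | h
    · rw [List.getElem_append_left h] at hc
      rw [List.take_append_of_le_length (by omega)]
      exact h1 o h c hc
    · obtain ⟨d, rfl⟩ := Nat.exists_eq_add_of_le h
      rw [List.getElem_append_right (by omega)] at hc
      simp only [Nat.add_sub_cancel_left] at hc
      rw [List.take_length_add_append, ← List.append_assoc]
      exact h2 d (by omega) c hc

theorem Forced.append_left {w z : List ℕ} (h : Forced w z) (x : List ℕ) :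
    Forced (x ++ w) z := fun o ho c hc => by
  rw [List.append_assoc]
  exact (h o ho c hc).append_left x

theorem Forced.of_nil {z : List ℕ} (h : Forced [] z) (w : List ℕ) : Forced w z := by
  simpa using h.append_left w

theorem forced_singleton {w : List ℕ} {a : ℕ} : Forced w [a] ↔ ∀ c < a, Blocked w c := by
  constructor
  · intro h c hc
    simpa using h 0 (by simp) c (by simpa using hc)
  · intro h o ho c hc
    have : o = 0 := by simpa using ho
    subst this
    simpa using h c (by simpa using hc)

/-! ### Concatenations of blocks -/

theorem occursAt_append {x y : List ℕ} {s : ℕ → ℕ} {i : ℕ} :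
    OccursAt (x ++ y) (inf s) i ↔ OccursAt x (inf s) i ∧ OccursAt y (inf s) (i + x.length) := by
  simp only [occursAt_inf_iff, List.length_append]
  constructor
  · intro h
    refine ⟨fun j hj => ?_, fun j hj => ?_⟩
    · rw [h j (by omega), List.getElem_append_left hj]
    · rw [Nat.add_assoc, h (x.length + j) (by omega), List.getElem_append_right (by omega)]
      simp
  · rintro ⟨h1, h2⟩ j hj
    rcases Nat.lt_or_ge j x.length with h | h
    · rw [List.getElem_append_left h, h1 j h]
    · obtain ⟨d, rfl⟩ := Nat.exists_eq_add_of_le h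
      rw [List.getElem_append_right (by omega)]
      simp only [Nat.add_sub_cancel_left]
      rw [← h2 d (by omega), Nat.add_assoc]

theorem Word.OccursAt.of_isPrefix {x v : List ℕ} {s : ℕ → ℕ} {i : ℕ} (h : OccursAt v (inf s) i)
    (hx : x <+: v) : OccursAt x (inf s) i := by
  obtain ⟨y, rfl⟩ := hx
  exact (occursAt_append.mp h).1

theorem Word.OccursAt.drop {v : List ℕ} {s : ℕ → ℕ} {i o : ℕ} (h : OccursAt v (inf s) i)
    (ho : o ≤ v.length) : OccursAt (v.drop o) (inf s) (i + o) := by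
  rw [← List.take_append_drop o v, occursAt_append] at h
  simpa [ho] using h.2

theorem Word.OccursAt.prefix_drop {x v : List ℕ} {s : ℕ → ℕ} {i o : ℕ} (hv : OccursAt v (inf s) i)
    (hx : OccursAt x (inf s) (i + o)) (ho : o + x.length ≤ v.length) : x <+: v.drop o := by
  rw [occursAt_inf_iff] at hv hx
  rw [List.prefix_iff_getElem]
  refine ⟨by simp; omega, fun j hj => ?_⟩
  rw [← hx j hj, List.getElem_drop, ← hv (o + j) (by omega), Nat.add_assoc]

/-- The number of letters before block `k` in the concatenation of the blocks `b (u k)`. -/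
def pos (b : ℕ → List ℕ) (u : ℕ → ℕ) (k : ℕ) : ℕ := (mapList b (takeInf u k)).length

/-- The infinite concatenation `b (u 0) b (u 1) b (u 2) ⋯` (for nonempty blocks). -/
def cat (b : ℕ → List ℕ) (u : ℕ → ℕ) (i : ℕ) : ℕ := (mapList b (takeInf u (i + 1))).getD i 0

theorem mapList_append (b : ℕ → List ℕ) (x y : List ℕ) :
    mapList b (x ++ y) = mapList b x ++ mapList b y := List.flatMap_append

@[simp] theorem mapList_singleton (b : ℕ → List ℕ) (n : ℕ) : mapList b [n] = b n := by
  simp [mapList]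

theorem mapList_takeInf_succ (b : ℕ → List ℕ) (u : ℕ → ℕ) (k : ℕ) :
    mapList b (takeInf u (k + 1)) = mapList b (takeInf u k) ++ b (u k) := by
  rw [takeInf_succ, mapList_append, mapList_singleton]

@[simp] theorem pos_zero (b : ℕ → List ℕ) (u : ℕ → ℕ) : pos b u 0 = 0 := rfl

theorem pos_succ (b : ℕ → List ℕ) (u : ℕ → ℕ) (k : ℕ) :
    pos b u (k + 1) = pos b u k + (b (u k)).length := by
  simp [pos, mapList_takeInf_succ]

theorem pos_lt_succ {b : ℕ → List ℕ} (hb : ∀ n, b n ≠ []) (u : ℕ → ℕ) (k : ℕ) :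
    pos b u k < pos b u (k + 1) := by
  have := List.length_pos_iff.mpr (hb (u k))
  rw [pos_succ]; omega

theorem pos_strictMono {b : ℕ → List ℕ} (hb : ∀ n, b n ≠ []) (u : ℕ → ℕ) :
    StrictMono (pos b u) := strictMono_nat_of_lt_succ (pos_lt_succ hb u)

theorem mapList_takeInf_mono (b : ℕ → List ℕ) (u : ℕ → ℕ) {k m : ℕ} (h : k ≤ m) :
    mapList b (takeInf u k) <+: mapList b (takeInf u m) := by
  obtain ⟨d, rfl⟩ := Nat.exists_eq_add_of_le h
  rw [takeInf_add, mapList_append]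
  exact List.prefix_append _ _

theorem takeInf_cat {b : ℕ → List ℕ} (hb : ∀ n, b n ≠ []) (u : ℕ → ℕ) (k : ℕ) :
    takeInf (cat b u) (pos b u k) = mapList b (takeInf u k) := by
  refine List.ext_getElem (by simp [pos]) fun j h1 h2 => ?_
  have hj : j < (mapList b (takeInf u (j + 1))).length := (pos_strictMono hb u).le_apply
  rw [getElem_takeInf, cat, List.getD_eq_getElem _ _ hj]
  rcases Nat.le_total k (j + 1) with h | h
  · exact ((mapList_takeInf_mono b u h).getElem h2).symm
  · exact (mapList_takeInf_mono b u h).getElem hj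

theorem occursAt_takeInf (s : ℕ → ℕ) (k : ℕ) : OccursAt (takeInf s k) (inf s) 0 := by
  rw [occursAt_inf_iff]; simp

theorem occursAt_cat {b : ℕ → List ℕ} (hb : ∀ n, b n ≠ []) (u : ℕ → ℕ) (k : ℕ) :
    OccursAt (b (u k)) (inf (cat b u)) (pos b u k) := by
  have h := occursAt_takeInf (cat b u) (pos b u (k + 1))
  rw [takeInf_cat hb, mapList_takeInf_succ, occursAt_append, Nat.zero_add] at h
  exact h.2

theorem exists_pos_le_lt {b : ℕ → List ℕ} (hb : ∀ n, b n ≠ []) (u : ℕ → ℕ) (i : ℕ) :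
    ∃ k, pos b u k ≤ i ∧ i < pos b u (k + 1) := by
  induction i with
  | zero => exact ⟨0, le_rfl, (pos_lt_succ hb u 0)⟩
  | succ i ih =>
    obtain ⟨k, h1, h2⟩ := ih
    rcases Nat.lt_or_ge (i + 1) (pos b u (k + 1)) with h | h
    · exact ⟨k, by omega, h⟩
    · exact ⟨k + 1, h, by have := pos_lt_succ hb u (k + 1); omega⟩

theorem applyMorphism_inf {b : ℕ → List ℕ} (hb : ∀ n, b n ≠ []) (u : ℕ → ℕ) :
    applyMorphism b (inf u) = inf (cat b u) := by
  have h : ¬ ∃ k, ∀ j, k ≤ j → b (u j) = [] := fun ⟨k, hk⟩ => hb _ (hk k le_rfl)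
  simp only [applyMorphism, dif_neg h, inf.injEq]
  funext i
  generalize_proofs h1 h2
  generalize Nat.find h1 = k at h2
  have h3 : i < (takeInf (cat b u) (pos b u k)).length := by simpa [pos] using h2
  have h4 := getElem_takeInf _ _ _ h3
  simp only [takeInf_cat hb] at h4
  exact h4

theorem cat_last {b : ℕ → List ℕ} (hb : ∀ n, b n ≠ []) (u : ℕ → ℕ) (k : ℕ) :
    (b (u k)).getLast? = some (cat b u (pos b u (k + 1) - 1)) := by
  have hl := List.length_pos_iff.mpr (hb (u k))
  have h := occursAt_inf_iff.mp (occursAt_cat hb u k) ((b (u k)).length - 1) (by omega)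
  rw [List.getLast?_eq_getElem?, List.getElem?_eq_getElem (by omega), ← h, pos_succ]
  congr 2; omega

/-! ### Squares in concatenations of blocks -/

section Aligned

variable {b : ℕ → List ℕ} {u : ℕ → ℕ} {i p t : ℕ}

/-- The last letters being distinct, blocks that end at places of the first half of the square, and
at the places one period later, agree. -/
theorem IsSq.extend_left (hb : ∀ n, b n ≠ [])
    (hlast : ∀ m n, (b m).getLast? = (b n).getLast? → m = n) (h : IsSq (cat b u) i p) (k : ℕ)
    (hkt : pos b u (k + t) = pos b u k + p) (hk : pos b u k ≤ i + p) :
    ∃ lo ≤ k, (∀ j, lo ≤ j → j < k → u j = u (j + t)) ∧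
      pos b u (lo + t) = pos b u lo + p ∧ pos b u lo ≤ i := by
  induction k with
  | zero => exact ⟨0, le_rfl, by omega, hkt, by simp⟩
  | succ k ih =>
    rcases Nat.lt_or_ge i (pos b u (k + 1)) with hi | hi
    · have h1 := cat_last hb u k
      have h2 := cat_last hb u (k + t)
      have h3 := h.2 (pos b u (k + 1) - 1 - i) (by omega)
      rw [show i + (pos b u (k + 1) - 1 - i) = pos b u (k + 1) - 1 by omega,
        show i + p + (pos b u (k + 1) - 1 - i) = pos b u (k + t + 1) - 1 by
          rw [show k + t + 1 = k + 1 + t by omega]; omega] at h3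
      have h4 : u k = u (k + t) := hlast _ _ (by rw [h1, h2, h3])
      have h5 := pos_lt_succ hb u k
      obtain ⟨lo, hlo, heq, hpos, hle⟩ := ih (by
        rw [show k + 1 + t = k + t + 1 by omega, pos_succ, pos_succ, h4] at hkt
        omega) (by omega)
      refine ⟨lo, by omega, fun j hj1 hj2 => ?_, hpos, hle⟩
      rcases Nat.lt_or_eq_of_le (Nat.le_of_lt_succ hj2) with h6 | rfl
      · exact heq j hj1 h6
      · exact h4
    · exact ⟨k + 1, le_rfl, by omega, hkt, hi⟩

/-- The blocks forming a prefix code, blocks of the first half of the square and the blocks one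
period later agree. Here `m` bounds the length that is left to compare. -/
theorem IsSq.extend_right (hb : ∀ n, b n ≠ []) (hpre : ∀ m n, b m <+: b n → m = n)
    (h : IsSq (cat b u) i p) (m k : ℕ) (hm : i + p ≤ pos b u k + m)
    (hkt : pos b u (k + t) = pos b u k + p) (hk : i ≤ pos b u k) :
    ∃ hi, k ≤ hi ∧ (∀ j, k ≤ j → j < hi → u j = u (j + t)) ∧ i + p < pos b u (hi + 1) := by
  induction m generalizing k with
  | zero => exact ⟨k, le_rfl, by omega, by have := pos_lt_succ hb u k; omega⟩
  | succ m ih =>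
    rcases Nat.lt_or_ge (i + p) (pos b u (k + 1)) with hi | hi
    · exact ⟨k, le_rfl, by omega, hi⟩
    · have hx := occursAt_cat hb u k
      have hy := occursAt_cat hb u (k + t)
      rw [occursAt_inf_iff] at hx hy
      have hlen := pos_succ b u k
      have hxy : ∀ a (h1 : a < (b (u k)).length) (h2 : a < (b (u (k + t))).length),
          (b (u k))[a] = (b (u (k + t)))[a] := by
        intro a h1 h2
        rw [← hx a h1, ← hy a h2, hkt]
        have h3 := h.2 (pos b u k + a - i) (by omega)
        rw [show i + (pos b u k + a - i) = pos b u k + a by omega,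
          show i + p + (pos b u k + a - i) = pos b u k + p + a by omega] at h3
        exact h3
      have h4 : u k = u (k + t) := by
        rcases Nat.le_total (b (u k)).length (b (u (k + t))).length with h5 | h5
        · exact hpre _ _ (List.prefix_iff_getElem.mpr
            ⟨h5, fun a ha => hxy a ha (by omega)⟩)
        · exact (hpre _ _ (List.prefix_iff_getElem.mpr
            ⟨h5, fun a ha => (hxy a (by omega) ha).symm⟩)).symm
      have h5 := pos_lt_succ hb u k
      obtain ⟨hi', h6, h7, h8⟩ := ih (k + 1) (by omega) (by
        rw [show k + 1 + t = k + t + 1 by omega, pos_succ, pos_succ, ← h4]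
        omega) (by omega)
      refine ⟨hi', by omega, fun j hj1 hj2 => ?_, h8⟩
      rcases Nat.lt_or_eq_of_le hj1 with h9 | rfl
      · exact h7 j h9 hj2
      · exact h4

/-- Let the blocks `b n` form a prefix code with pairwise distinct last letters. If the period of
a square in a concatenation of blocks carries a block boundary in the first half to a block
boundary, then the square stems from a square of blocks: the agreement of blocks extends to the
left because of the last letters, and to the right because of the prefix code. -/
theorem IsSq.exists_isSq_of_aligned (hb : ∀ n, b n ≠ []) (hpre : ∀ m n, b m <+: b n → m = n)
    (hlast : ∀ m n, (b m).getLast? = (b n).getLast? → m = n) (h : IsSq (cat b u) i p) {k : ℕ}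
    (hkt : pos b u (k + t) = pos b u k + p) (h1 : i ≤ pos b u k) (h2 : pos b u k ≤ i + p) :
    ∃ lo, IsSq u lo t ∧ pos b u (lo + t) = pos b u lo + p := by
  obtain ⟨lo, hlo, heq, hpos, hle⟩ := h.extend_left hb hlast k hkt h2
  obtain ⟨hi, hhi, heq', hlt⟩ := h.extend_right hb hpre p k (by omega) hkt h1
  have h3 : lo + t < hi + 1 := (pos_strictMono hb u).lt_iff_lt.mp (by omega)
  refine ⟨lo, ⟨?_, fun a ha => ?_⟩, hpos⟩
  · rcases Nat.eq_zero_or_pos t with rfl | ht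
    · have := h.1
      rw [Nat.add_zero] at hpos
      omega
    · exact ht
  · rw [show lo + t + a = lo + a + t by omega]
    rcases Nat.lt_or_ge (lo + a) k with h4 | h4
    · exact heq _ (by omega) h4
    · exact heq' _ h4 (by omega)

end Aligned

/-! ### Words separated by copies of a word -/

/-- No square occurs in the finite word `X`. (The letters `0` that `getD` supplies beyond the end
of `X` do not matter.) -/
def SqFree (X : List ℕ) : Prop := ∀ i p, IsSq (fun j => X.getD j 0) i p → X.length < i + 2 * p

theorem SqFree.not_isSq {X : List ℕ} (hX : SqFree X) {s : ℕ → ℕ} {g i p : ℕ}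
    (hs : OccursAt X (inf s) g) (h : IsSq s i p) (hi : g ≤ i) :
    g + X.length < i + 2 * p := by
  by_contra hle
  push Not at hle
  rw [occursAt_inf_iff] at hs
  have := hX (i - g) p (h.congr fun a ha => by
    rw [List.getD_eq_getElem _ _ (by omega), ← hs _ (by omega)]
    congr 1; omega)
  omega

/-- Words `γ n` (the `contents`) that can be separated by copies of the word `D`. Apart from
`γ 0`, all contents have letters at least `ℓ`, the first of them after the common prefix `h`, and
one of them at the end; `D` and `γ 0` have no such letters. The word `D ++ γ 0 ++ D ++ h`, which
is what can be seen between two such letters, is square-free. The factor `f` of `D`, at position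
`a` and at distance `d` from the end of `D`, does not occur in the contents. -/
structure Separated (D h f : List ℕ) (γ : ℕ → List ℕ) (ℓ a d : ℕ) : Prop where
  sep_lt : ∀ x ∈ D, x < ℓ
  zero_lt : ∀ x ∈ γ 0, x < ℓ
  head_lt : ∀ x ∈ h, x < ℓ
  exists_head : ∀ n, n ≠ 0 → ∃ x, ℓ ≤ x ∧ h ++ [x] <+: γ n
  exists_last : ∀ n, n ≠ 0 → ∃ x, ℓ ≤ x ∧ (γ n).getLast? = some x
  ne_nil : ∀ n, γ n ≠ []
  prefix_free : ∀ m n, γ m <+: γ n → m = n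
  last_inj : ∀ m n, (γ m).getLast? = (γ n).getLast? → m = n
  sqFree : SqFree (D ++ γ 0 ++ D ++ h)
  eq_of_prefix_drop : ∀ g, D <+: (D ++ γ 0 ++ D ++ h).drop g → g = 0 ∨ g = (D ++ γ 0).length
  mark_ne_nil : f ≠ []
  not_isInfix_mark : ∀ n, n ≠ 0 → ¬ f <:+: γ n
  mark_left : f <+: D.drop a
  mark_right : f <+: D.drop (D.length - d)
  le_length : d ≤ D.length

namespace Separated

variable {D h f : List ℕ} {γ : ℕ → List ℕ} {ℓ a d : ℕ} {u : ℕ → ℕ}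

theorem block_ne_nil (H : Separated D h f γ ℓ a d) (n : ℕ) : D ++ γ n ≠ [] := by
  simp [H.ne_nil n]

theorem block_prefix_free (H : Separated D h f γ ℓ a d) (m n : ℕ)
    (hmn : D ++ γ m <+: D ++ γ n) : m = n :=
  H.prefix_free m n ((List.prefix_append_right_inj D).mp hmn)

theorem block_last_inj (H : Separated D h f γ ℓ a d) (m n : ℕ)
    (hmn : (D ++ γ m).getLast? = (D ++ γ n).getLast?) : m = n := by
  rw [List.getLast?_append_of_ne_nil _ (H.ne_nil m),
    List.getLast?_append_of_ne_nil _ (H.ne_nil n)] at hmn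
  exact H.last_inj m n hmn

theorem occursAt_sep (H : Separated D h f γ ℓ a d) (k : ℕ) :
    OccursAt D (inf (cat (fun n => D ++ γ n) u)) (pos (fun n => D ++ γ n) u k) :=
  (occursAt_append.mp (occursAt_cat (b := fun n => D ++ γ n) H.block_ne_nil u k)).1

theorem occursAt_content (H : Separated D h f γ ℓ a d) (k : ℕ) :
    OccursAt (γ (u k)) (inf (cat (fun n => D ++ γ n) u))
      (pos (fun n => D ++ γ n) u k + D.length) :=
  (occursAt_append.mp (occursAt_cat (b := fun n => D ++ γ n) H.block_ne_nil u k)).2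

theorem pos_succ' (k : ℕ) : pos (fun n => D ++ γ n) u (k + 1) =
    pos (fun n => D ++ γ n) u k + D.length + (γ (u k)).length := by
  rw [pos_succ, List.length_append]; omega

theorem occursAt_between (H : Separated D h f γ ℓ a d) (hu : ∀ k, u k = 0 ↔ Even k) {k : ℕ}
    (hk : Even k) :
    OccursAt (D ++ γ 0 ++ D ++ h) (inf (cat (fun n => D ++ γ n) u))
      (pos (fun n => D ++ γ n) u k) := by
  have h0 := (hu k).mpr hk
  obtain ⟨x, -, hx⟩ := H.exists_head (u (k + 1)) (by
    rw [Ne, hu, Nat.even_add_one]; simpa using hk)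
  have h2 := (H.occursAt_content (u := u) (k + 1)).of_isPrefix ((List.prefix_append h [x]).trans hx)
  have h3 := H.occursAt_content (u := u) k
  rw [h0] at h3
  rw [List.append_assoc, List.append_assoc, occursAt_append, occursAt_append, occursAt_append]
  have h4 := pos_succ' (D := D) (γ := γ) (u := u) k
  rw [h0] at h4
  rw [← h4]
  exact ⟨H.occursAt_sep k, h3, H.occursAt_sep _, h2⟩

/-- Letters at least `ℓ` occur only in the contents of odd blocks. -/
theorem exists_odd_of_le (H : Separated D h f γ ℓ a d) (hu : ∀ k, u k = 0 ↔ Even k) {c : ℕ}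
    (hc : ℓ ≤ cat (fun n => D ++ γ n) u c) :
    ∃ k, Odd k ∧ pos (fun n => D ++ γ n) u k + D.length ≤ c ∧
      c < pos (fun n => D ++ γ n) u (k + 1) := by
  obtain ⟨k, h1, h2⟩ := exists_pos_le_lt (b := fun n => D ++ γ n) H.block_ne_nil u c
  have hD : pos (fun n => D ++ γ n) u k + D.length ≤ c := by
    by_contra hlt
    push Not at hlt
    obtain ⟨j, rfl⟩ := Nat.exists_eq_add_of_le h1
    rw [occursAt_inf_iff.mp (H.occursAt_sep k) j (by omega)] at hc
    exact absurd (H.sep_lt _ (List.getElem_mem (l := D) (n := j) (by omega))) (by omega)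
  refine ⟨k, ?_, hD, h2⟩
  rw [← Nat.not_even_iff_odd, ← hu]
  intro h0
  obtain ⟨j, rfl⟩ := Nat.exists_eq_add_of_le hD
  have h3 := H.occursAt_content (u := u) k
  rw [h0] at h3
  rw [pos_succ', h0] at h2
  rw [occursAt_inf_iff.mp h3 j (by omega)] at hc
  exact absurd (H.zero_lt _ (List.getElem_mem (l := γ 0) (n := j) (by omega))) (by omega)

/-- A factor without letters at least `ℓ` lies either between two such letters of consecutive
odd blocks or in the contents of one odd block. -/
theorem gap (H : Separated D h f γ ℓ a d) (hu : ∀ k, u k = 0 ↔ Even k) {i m : ℕ}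
    (hlt : ∀ c < m, cat (fun n => D ++ γ n) u (i + c) < ℓ) :
    (∃ k, Even k ∧ pos (fun n => D ++ γ n) u k ≤ i ∧
      i + m ≤ pos (fun n => D ++ γ n) u k + (D ++ γ 0 ++ D ++ h).length) ∨
    ∃ k, Odd k ∧ pos (fun n => D ++ γ n) u k + D.length ≤ i ∧
      i + m ≤ pos (fun n => D ++ γ n) u (k + 1) := by
  have large : ∀ c, ℓ ≤ cat (fun n => D ++ γ n) u c → i ≤ c → i + m ≤ c := by
    intro c hc hic
    by_contra h1
    have := hlt (c - i) (by omega)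
    rw [show i + (c - i) = c by omega] at this
    omega
  have hfirst : ∀ k, Odd k → i ≤ pos (fun n => D ++ γ n) u k + D.length + h.length →
      i + m ≤ pos (fun n => D ++ γ n) u k + D.length + h.length := by
    intro k hk hi
    have hk0 : u k ≠ 0 := by rw [Ne, hu]; simpa using hk
    obtain ⟨x, hx, hp⟩ := H.exists_head (u k) hk0
    have h1 := occursAt_inf_iff.mp ((H.occursAt_content (u := u) k).of_isPrefix hp) h.length (by simp)
    refine large _ ?_ hi
    rw [h1]; simpa using hx
  obtain ⟨k, h1, h2⟩ := exists_pos_le_lt (b := fun n => D ++ γ n) H.block_ne_nil u i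
  rcases Nat.even_or_odd k with hk | hk
  · left
    have h3 := hfirst (k + 1) hk.add_one (by omega)
    refine ⟨k, hk, h1, h3.trans ?_⟩
    rw [pos_succ', (hu k).mpr hk]
    simp only [List.length_append]; omega
  · rcases Nat.lt_or_ge i (pos (fun n => D ++ γ n) u k + D.length) with h3 | h3
    · left
      obtain ⟨k, rfl⟩ : ∃ k', k = k' + 1 := ⟨k - 1, by have := hk.pos; omega⟩
      have hk' : Even k := by simpa [Nat.odd_add_one] using hk
      have h4 := hfirst (k + 1) hk (by omega)
      have h5 := pos_succ' (D := D) (γ := γ) (u := u) k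
      rw [(hu k).mpr hk'] at h5
      refine ⟨k, hk', by omega, h4.trans ?_⟩
      rw [h5]
      simp only [List.length_append]; omega
    · right
      refine ⟨k, hk, h3, ?_⟩
      have hk0 : u k ≠ 0 := by rw [Ne, hu]; simpa using hk
      obtain ⟨x, hx, hp⟩ := H.exists_last (u k) hk0
      have h4 := cat_last (b := fun n => D ++ γ n) H.block_ne_nil u k
      rw [List.getLast?_append_of_ne_nil _ (H.ne_nil _), hp, Option.some.injEq] at h4
      have := large _ (h4 ▸ hx) (by omega)
      omega

/-- The mark does not occur in the contents of an odd block. -/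
theorem not_mark (H : Separated D h f γ ℓ a d) (hu : ∀ k, u k = 0 ↔ Even k) {k g : ℕ}
    (hk : Odd k) (h1 : pos (fun n => D ++ γ n) u k + D.length ≤ g)
    (h2 : g + f.length ≤ pos (fun n => D ++ γ n) u (k + 1)) :
    ¬ OccursAt f (inf (cat (fun n => D ++ γ n) u)) g := by
  intro hf
  obtain ⟨o, rfl⟩ := Nat.exists_eq_add_of_le h1
  have h3 := (H.occursAt_content (u := u) k).prefix_drop hf (by rw [pos_succ'] at h2; omega)
  exact H.not_isInfix_mark (u k) (by rw [Ne, hu]; simpa using hk)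
    (h3.isInfix.trans (List.drop_suffix _ _).isInfix)

/-- The separator occurs only where it is meant to. -/
theorem exists_eq_pos (H : Separated D h f γ ℓ a d) (hu : ∀ k, u k = 0 ↔ Even k) {g : ℕ}
    (hg : OccursAt D (inf (cat (fun n => D ++ γ n) u)) g) :
    ∃ k, g = pos (fun n => D ++ γ n) u k := by
  rcases H.gap hu (i := g) (fun c hc => by
    rw [occursAt_inf_iff.mp hg c hc]; exact H.sep_lt _ (List.getElem_mem _)) with
    ⟨k, hk, h1, h2⟩ | ⟨k, hk, h1, h2⟩
  · obtain ⟨o, rfl⟩ := Nat.exists_eq_add_of_le h1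
    rcases H.eq_of_prefix_drop o
      ((H.occursAt_between hu hk).prefix_drop hg (by omega)) with rfl | rfl
    · exact ⟨k, rfl⟩
    · refine ⟨k + 1, ?_⟩
      rw [pos_succ', (hu k).mpr hk, List.length_append]; omega
  · have h3 : a ≤ D.length := by
      have h4 := H.mark_left.length_le
      have h5 := List.length_pos_iff.mpr H.mark_ne_nil
      rw [List.length_drop] at h4
      omega
    refine absurd ((hg.drop h3).of_isPrefix H.mark_left) (H.not_mark hu hk (by omega) ?_)
    have h4 := H.mark_left.length_le
    rw [List.length_drop] at h4
    omega

/-- A square either comes from a square of blocks, or lies in the contents of an odd block together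
with short parts of the neighbouring separators. If a large letter in its first half and the copy
of that letter in the second half are in different blocks, then two separators with only `γ 0`
in between lie between these letters. One of the two separators is not cut by the centre of the
square, so that the period shifts a separator to a separator. Otherwise the two letters are in the
same block, and a mark `f` outside of this block would have a copy between them. -/
theorem isSq_cases (H : Separated D h f γ ℓ a d) (hu : ∀ k, u k = 0 ↔ Even k) {i p : ℕ}
    (hs : IsSq (cat (fun n => D ++ γ n) u) i p) :
    (∃ k t, IsSq u k t ∧
      pos (fun n => D ++ γ n) u (k + t) = pos (fun n => D ++ γ n) u k + p) ∨
    ∃ k, Odd k ∧ pos (fun n => D ++ γ n) u k + D.length < i + d ∧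
      i + 2 * p < pos (fun n => D ++ γ n) u (k + 1) + a + f.length := by
  have hmono := pos_strictMono (b := fun n => D ++ γ n) H.block_ne_nil u
  have hf := List.length_pos_iff.mpr H.mark_ne_nil
  have hp := hs.1
  have hd : f.length ≤ d := by
    have := H.mark_right.length_le
    rw [List.length_drop] at this
    omega
  have ha : a + f.length ≤ D.length := by
    have := H.mark_left.length_le
    rw [List.length_drop] at this
    omega
  by_cases hc : ∃ c, i ≤ c ∧ c < i + p ∧ ℓ ≤ cat (fun n => D ++ γ n) u c
  · obtain ⟨c, hc1, hc2, hc3⟩ := hc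
    have hcp : cat (fun n => D ++ γ n) u c = cat (fun n => D ++ γ n) u (c + p) := by
      have := hs.2 (c - i) (by omega)
      rwa [show i + (c - i) = c by omega, show i + p + (c - i) = c + p by omega] at this
    obtain ⟨k₁, ho1, hk1, hk1'⟩ := H.exists_odd_of_le hu hc3
    obtain ⟨k₂, ho2, hk2, hk2'⟩ := H.exists_odd_of_le hu (hcp ▸ hc3)
    have hle : k₁ < k₂ + 1 := hmono.lt_iff_lt.mp (by omega)
    rcases Nat.lt_or_eq_of_le (Nat.le_of_lt_succ hle) with hlt | rfl
    · left
      have hk12 : k₁ + 2 ≤ k₂ := by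
        obtain ⟨x, rfl⟩ := ho1
        obtain ⟨y, rfl⟩ := ho2
        omega
      have hpos2 := hmono.monotone hk12
      have hstep : pos (fun n => D ++ γ n) u (k₁ + 2) = _ :=
        pos_succ' (D := D) (γ := γ) (u := u) (k₁ + 1)
      -- If the centre `i + p` is not beyond the separator of block `k₁ + 1`, then the separator of
      -- block `k₁ + 2` lies in the second half.
      rcases Nat.lt_or_ge (i + p) (pos (fun n => D ++ γ n) u (k₁ + 1) + D.length) with h1 | h1
      · have hD := H.occursAt_sep (u := u) (k₁ + 2)
        obtain ⟨k, hk⟩ := H.exists_eq_pos hu (g := pos (fun n => D ++ γ n) u (k₁ + 2) - p) (by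
          rw [occursAt_inf_iff] at hD ⊢
          intro j hj
          rw [← hD j hj]
          have := hs.2 (pos (fun n => D ++ γ n) u (k₁ + 2) - p + j - i) (by omega)
          rw [show i + (pos (fun n => D ++ γ n) u (k₁ + 2) - p + j - i) =
              pos (fun n => D ++ γ n) u (k₁ + 2) - p + j by omega,
            show i + p + (pos (fun n => D ++ γ n) u (k₁ + 2) - p + j - i) =
              pos (fun n => D ++ γ n) u (k₁ + 2) + j by omega] at this
          exact this)
        have hk3 : k < k₁ + 2 := hmono.lt_iff_lt.mp (by omega)
        obtain ⟨lo, hlo, hlo'⟩ := hs.exists_isSq_of_aligned (k := k) (t := k₁ + 2 - k)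
          H.block_ne_nil H.block_prefix_free H.block_last_inj
          (by rw [show k + (k₁ + 2 - k) = k₁ + 2 by omega]; omega) (by omega) (by omega)
        exact ⟨lo, _, hlo, hlo'⟩
      · have hD := H.occursAt_sep (u := u) (k₁ + 1)
        obtain ⟨k, hk⟩ := H.exists_eq_pos hu (g := pos (fun n => D ++ γ n) u (k₁ + 1) + p) (by
          rw [occursAt_inf_iff] at hD ⊢
          intro j hj
          rw [← hD j hj]
          have := hs.2 (pos (fun n => D ++ γ n) u (k₁ + 1) + j - i) (by omega)
          rw [show i + (pos (fun n => D ++ γ n) u (k₁ + 1) + j - i) =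
              pos (fun n => D ++ γ n) u (k₁ + 1) + j by omega,
            show i + p + (pos (fun n => D ++ γ n) u (k₁ + 1) + j - i) =
              pos (fun n => D ++ γ n) u (k₁ + 1) + p + j by omega] at this
          exact this.symm)
        have hk3 : k₁ + 1 < k := hmono.lt_iff_lt.mp (by omega)
        obtain ⟨lo, hlo, hlo'⟩ := hs.exists_isSq_of_aligned (k := k₁ + 1) (t := k - (k₁ + 1))
          H.block_ne_nil H.block_prefix_free H.block_last_inj
          (by rw [show k₁ + 1 + (k - (k₁ + 1)) = k by omega]; omega) (by omega) (by omega)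
        exact ⟨lo, _, hlo, hlo'⟩
    · right
      refine ⟨k₁, ho1, ?_, ?_⟩
      · by_contra h1
        have hm := ((H.occursAt_sep (u := u) k₁).drop (Nat.sub_le _ d)).of_isPrefix H.mark_right
        have hdl := H.le_length
        refine H.not_mark hu (g := pos (fun n => D ++ γ n) u k₁ + (D.length - d) + p) ho1
          (by omega) (by omega) ?_
        rw [occursAt_inf_iff] at hm ⊢
        intro j hj
        rw [← hm j hj]
        have := hs.2 (pos (fun n => D ++ γ n) u k₁ + (D.length - d) + j - i) (by omega)
        rw [show i + (pos (fun n => D ++ γ n) u k₁ + (D.length - d) + j - i) =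
            pos (fun n => D ++ γ n) u k₁ + (D.length - d) + j by omega,
          show i + p + (pos (fun n => D ++ γ n) u k₁ + (D.length - d) + j - i) =
            pos (fun n => D ++ γ n) u k₁ + (D.length - d) + p + j by omega] at this
        exact this.symm
      · by_contra h1
        have hm := ((H.occursAt_sep (u := u) (k₁ + 1)).drop (o := a) (by omega)).of_isPrefix H.mark_left
        refine H.not_mark hu (g := pos (fun n => D ++ γ n) u (k₁ + 1) + a - p) ho1
          (by omega) (by omega) ?_
        rw [occursAt_inf_iff] at hm ⊢
        intro j hj
        rw [← hm j hj]
        have := hs.2 (pos (fun n => D ++ γ n) u (k₁ + 1) + a + j - p - i) (by omega)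
        rw [show i + (pos (fun n => D ++ γ n) u (k₁ + 1) + a + j - p - i) =
            pos (fun n => D ++ γ n) u (k₁ + 1) + a - p + j by omega,
          show i + p + (pos (fun n => D ++ γ n) u (k₁ + 1) + a + j - p - i) =
            pos (fun n => D ++ γ n) u (k₁ + 1) + a + j by omega] at this
        exact this
  · -- There is no large letter in the first half of the square, hence none in the square.
    right
    push Not at hc
    rcases H.gap hu (i := i) (m := 2 * p) (fun c hcp => by
      rcases Nat.lt_or_ge c p with h1 | h1
      · exact hc _ (by omega) (by omega)
      · rw [show i + c = i + p + (c - p) by omega, ← hs.2 (c - p) (by omega)]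
        exact hc _ (by omega) (by omega)) with ⟨k, hk, h1, h2⟩ | ⟨k, hk, h1, h2⟩
    · have := H.sqFree.not_isSq (H.occursAt_between hu hk) hs h1
      omega
    · exact ⟨k, hk, by omega, by omega⟩

end Separated

/-! ### Tests for finite words -/

/-- `k n`, in a form that makes the kernel evaluate `n` before it continues with `k`. -/
def force {β : Type} (n : ℕ) (k : ℕ → β) : β :=
  Nat.rec (motive := fun _ => β) (k 0) (fun m _ => k (m + 1)) n

theorem force_eq {β : Type} (n : ℕ) (k : ℕ → β) : force n k = k n := by
  cases n <;> rfl

/-- The number whose binary digits, lowest first, are the `b`-th bits of the letters of `ys.reverse`,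
followed by the digits of `acc`, where `ys` is the list argument. -/
def bitPlaneAux (b : ℕ) : List ℕ → ℕ → ℕ
  | [], acc => acc
  | x :: xs, acc => force (2 * acc + x / 2 ^ b % 2) fun y => bitPlaneAux b xs y

/-- The number whose binary digit at place `i` is the `b`-th bit of the letter `X[i]`. -/
def bitPlane (b : ℕ) (X : List ℕ) : ℕ := bitPlaneAux b X.reverse 0

theorem testBit_bitPlane (b : ℕ) (X : List ℕ) (i : ℕ) :
    (bitPlane b X).testBit i = (X.getD i 0).testBit b := by
  have step : ∀ (ys : List ℕ) (acc : ℕ), bitPlaneAux b ys acc =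
      ys.foldl (fun a x => 2 * a + x / 2 ^ b % 2) acc := by
    intro ys
    induction ys with
    | nil => intro acc; rfl
    | cons y ys ih => intro acc; simp [bitPlaneAux, force_eq, ih]
  rw [bitPlane, step, List.foldl_reverse]
  induction X generalizing i with
  | nil => simp
  | cons x xs ih =>
    rw [List.foldr_cons]
    cases i with
    | zero => rw [Nat.testBit_zero]; simp [Nat.testBit_eq_decide_div_mod_eq]
    | succ i =>
      rw [Nat.testBit_succ, show ∀ m : ℕ, (2 * m + x / 2 ^ b % 2) / 2 = m by omega, ih]
      simp

/-- The bitwise disjunction of `d >>> a` over `a < p`, found by doubling (`fuel` doublings). -/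
def spread : ℕ → ℕ → ℕ → ℕ
  | 0, _, d => d
  | fuel + 1, p, d =>
    if p ≤ 1 then d
    else force (spread fuel ((p + 1) / 2) d) fun z => z ||| (z >>> (p - (p + 1) / 2))

theorem exists_testBit_of_spread (fuel p d i : ℕ) (hp : 0 < p)
    (h : (spread fuel p d).testBit i = true) : ∃ a < p, d.testBit (i + a) = true := by
  induction fuel generalizing p i with
  | zero => exact ⟨0, hp, h⟩
  | succ fuel ih =>
    rw [spread] at h
    split_ifs at h with h1
    · exact ⟨0, hp, h⟩
    · rw [force_eq, Nat.testBit_or, Nat.testBit_shiftRight, Bool.or_eq_true] at h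
      rcases h with h | h
      · obtain ⟨a, ha, h2⟩ := ih _ _ (by omega) h
        exact ⟨a, by omega, h2⟩
      · obtain ⟨a, ha, h2⟩ := ih _ _ (by omega) h
        exact ⟨p - (p + 1) / 2 + a, by omega, by rw [← h2]; congr 1; omega⟩

/-- Test for squares of period `p` in a word of length `n` given by its three bit planes: every
factor of length `p` has a letter that differs from the letter `p` places further on. -/
def noSqOfPeriod (n b₀ b₁ b₂ p : ℕ) : Bool :=
  force ((b₀ ^^^ (b₀ >>> p)) ||| ((b₁ ^^^ (b₁ >>> p)) ||| (b₂ ^^^ (b₂ >>> p)))) fun d =>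
    force (spread 12 p d) fun z => z % 2 ^ (n + 1 - 2 * p) == 2 ^ (n + 1 - 2 * p) - 1

/-- Test for squares of the periods `1, …, p`. -/
def noSqUpTo (n b₀ b₁ b₂ : ℕ) : ℕ → Bool
  | 0 => true
  | p + 1 => noSqOfPeriod n b₀ b₁ b₂ (p + 1) && noSqUpTo n b₀ b₁ b₂ p

/-- Test for square-freeness, looking at the last three bits of the letters only. With `12`
doublings, `spread` covers all periods up to `2 ^ 12`. -/
def sqFreeTest (X : List ℕ) : Bool :=
  force X.length fun n => force (bitPlane 0 X) fun b₀ => force (bitPlane 1 X) fun b₁ =>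
    force (bitPlane 2 X) fun b₂ => noSqUpTo n b₀ b₁ b₂ (n / 2)

theorem sqFree_of_sqFreeTest {X : List ℕ} (h : sqFreeTest X = true) : SqFree X := by
  simp only [sqFreeTest, force_eq] at h
  intro i p hs
  by_contra hle
  push Not at hle
  have hp := hs.1
  have hper : ∀ m, p ≤ m → noSqUpTo X.length (bitPlane 0 X) (bitPlane 1 X) (bitPlane 2 X) m = true →
      noSqOfPeriod X.length (bitPlane 0 X) (bitPlane 1 X) (bitPlane 2 X) p = true := by
    intro m
    induction m with
    | zero => intro h1; omega
    | succ m ih =>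
      intro h1 h2
      rw [noSqUpTo, Bool.and_eq_true] at h2
      rcases Nat.lt_or_eq_of_le h1 with h3 | rfl
      · exact ih (by omega) h2.2
      · exact h2.1
  have h1 := hper _ (by omega) h
  simp only [noSqOfPeriod, force_eq, beq_iff_eq] at h1
  have h2 := congrArg (fun m => m.testBit i) h1
  simp only [Nat.testBit_mod_two_pow, Nat.testBit_two_pow_sub_one,
    show i < X.length + 1 - 2 * p by omega, decide_true, Bool.true_and] at h2
  obtain ⟨a, ha, h3⟩ := exists_testBit_of_spread _ _ _ _ hp h2
  have h4 := hs.2 a ha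
  simp only [Nat.testBit_or, Nat.testBit_xor, Nat.testBit_shiftRight, testBit_bitPlane,
    show p + (i + a) = i + p + a by omega, h4, bne_self_eq_false, Bool.or_false,
    Bool.false_eq_true] at h3

/-- Test whether `c` completes a square, with a period from the list `P`, after the word with
reversal `v`. -/
def blockedTest (P v : List ℕ) (c : ℕ) : Bool :=
  P.any fun p => decide (0 < p) && ((c :: v).take p).isPrefixOf ((c :: v).drop p)

theorem blocked_of_blockedTest {P v : List ℕ} {c : ℕ} (h : blockedTest P v c = true) :
    Blocked v.reverse c := by
  simp only [blockedTest, List.any_eq_true, Bool.and_eq_true, decide_eq_true_eq] at h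
  obtain ⟨p, -, hp, h⟩ := h
  rw [List.isPrefixOf_iff_prefix] at h
  obtain ⟨z, hz⟩ := h
  refine ⟨((c :: v).take p).reverse, ?_, z.reverse, ?_⟩
  · simp; omega
  · rw [← List.reverse_append, ← List.reverse_append, List.append_assoc, hz,
      List.take_append_drop, List.reverse_cons]

/-- Test whether all letters of a word are forced after the word with reversal `v`. -/
def forcedTest (P : List ℕ) : List ℕ → List ℕ → Bool
  | _, [] => true
  | v, x :: xs => force x fun y =>
    (List.range y).all (fun c => blockedTest P v c) && forcedTest P (y :: v) xs

theorem forced_of_forcedTest {P v X : List ℕ} (h : forcedTest P v X = true) :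
    Forced v.reverse X := by
  induction X generalizing v with
  | nil => intro o ho; simp at ho
  | cons x xs ih =>
    simp only [forcedTest, force_eq, Bool.and_eq_true, List.all_eq_true, List.mem_range] at h
    rw [show x :: xs = [x] ++ xs from rfl, forced_append, forced_singleton]
    refine ⟨fun c hc => blocked_of_blockedTest (h.1 c hc), ?_⟩
    simpa using ih h.2

/-- Test whether `D` occurs in a word only at the positions `0` and `m`; the positions are counted
from `g`. -/
def occursTest (D : List ℕ) (m : ℕ) : ℕ → List ℕ → Bool
  | _, [] => true
  | g, x :: xs => force g fun g' =>
    (g' == 0 || g' == m || !D.isPrefixOf (x :: xs)) && occursTest D m (g' + 1) xs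

theorem eq_of_occursTest {D X : List ℕ} {m g o : ℕ} (hD : D ≠ [])
    (h : occursTest D m g X = true) (hX : D <+: X.drop o) : g + o = 0 ∨ g + o = m := by
  induction X generalizing g o with
  | nil => simp at hX; exact absurd hX hD
  | cons x xs ih =>
    simp only [occursTest, force_eq, Bool.and_eq_true, Bool.or_eq_true, beq_iff_eq,
      Bool.not_eq_true'] at h
    cases o with
    | zero =>
      rcases h.1 with h1 | h1
      · exact h1
      · rw [List.drop_zero, ← List.isPrefixOf_iff_prefix, h1] at hX
        simp at hX
    | succ o =>
      have := ih h.2 hX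
      omega

/-! ### Explicit forms of the finite words -/

theorem exists_L_eq (p : List ℕ) : ∃ s, IsLeastCompletion p s ∧ L (fin p) = inf s :=
  ⟨_, Classical.choose_spec (exists_isLeastCompletion p), rfl⟩

theorem IsCompletion.occursAt {p : List ℕ} {s : ℕ → ℕ} (h : IsCompletion p s) :
    OccursAt p (inf s) 0 := h.1

theorem SqFree.not_isSq_of_isCompletion {p : List ℕ} {s : ℕ → ℕ} (hp : SqFree p)
    (h : IsCompletion p s) (i q : ℕ) : ¬ IsSq s i q := fun hs => by
  have h1 := hp.not_isSq h.occursAt hs (Nat.zero_le _)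
  have h2 := (isCompletion_iff.mp h).2 i q hs
  omega

theorem takeInf_eq_take {p : List ℕ} {s : ℕ → ℕ} (h : OccursAt p (inf s) 0) {j : ℕ}
    (hj : j ≤ p.length) : takeInf s j = p.take j := by
  rw [occursAt_inf_iff] at h
  refine List.ext_getElem (by simp [hj]) fun i h1 h2 => ?_
  rw [getElem_takeInf, List.getElem_take, ← h i (by simp at h1; omega), Nat.zero_add]

/-- If no square occurs in `p ++ z` and `z` is forced after `p`, then `p` and `p ++ z` have the
same least completion. -/
theorem L_eq_L_append {p z : List ℕ} (h : SqFree (p ++ z)) (hz : Forced p z) :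
    L (fin p) = L (fin (p ++ z)) := by
  obtain ⟨s, hs, hL⟩ := exists_L_eq (p ++ z)
  rw [hL]
  refine IsLeastCompletion.L_eq ?_
  have hc := hs.1
  rw [isLeastCompletion_iff, isCompletion_iff] at hs ⊢
  refine ⟨⟨?_, fun i q hq => absurd hq (h.not_isSq_of_isCompletion hc i q)⟩, fun j hj c hcj => ?_⟩
  · rw [takeInf_eq_take hc.occursAt (by simp), List.take_left']
    rfl
  · rcases Nat.lt_or_ge j (p ++ z).length with h1 | h1
    · rw [List.length_append] at h1
      obtain ⟨o, rfl⟩ := Nat.exists_eq_add_of_le hj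
      rw [takeInf_eq_take hc.occursAt (by rw [List.length_append]; omega),
        List.take_length_add_append]
      refine hz o (by omega) c ?_
      have h2 := occursAt_inf_iff.mp hc.occursAt (p.length + o) (by rw [List.length_append]; omega)
      rw [Nat.zero_add, List.getElem_append_right (by omega)] at h2
      simpa [h2] using hcj
    · exact hs.2 j h1 c hcj

/-- If the greedy continuation of `n` follows the ruler sequence for `k` letters and then deviates
from it with the letter `x`, then `P0 n` has length `k`. -/
theorem P0_eq_of_forced {n k x : ℕ} (hx : x ≠ ruler k)
    (h : SqFree ([n] ++ (takeInf ruler k ++ [x]))) (hf : Forced [n] (takeInf ruler k ++ [x])) :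
    P0 n = takeInf ruler k := by
  obtain ⟨s, hs, hL⟩ := exists_L_eq ([n] ++ (takeInf ruler k ++ [x]))
  have ho := hs.1.occursAt
  rw [P0, L_eq_L_append h hf, hL]
  congr 1
  refine IsGreatest.csSup_eq ⟨?_, fun m hm => ?_⟩
  · refine ho.of_isPrefix ?_
    rw [← List.append_assoc]
    exact List.prefix_append _ _
  · by_contra hlt
    push Not at hlt
    have h1 := occursAt_inf_iff.mp hm (k + 1) (by simp; omega)
    have h2 := occursAt_inf_iff.mp ho (k + 1) (by simp)
    simp at h1 h2
    exact hx (h2.symm.trans h1)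

theorem P0_two : P0 2 = [0, 1, 0, 2, 0, 1] := by
  have h : takeInf ruler 6 = [0, 1, 0, 2, 0, 1] := by decide +kernel
  rw [← h]
  refine P0_eq_of_forced (x := 2) (by decide +kernel) ?_ ?_ <;> rw [h]
  · exact sqFree_of_sqFreeTest (by decide +kernel)
  · exact forced_of_forcedTest (P := [1, 2, 3, 4]) (v := [2]) (by decide +kernel)

theorem P0_three : P0 3 = [0, 1, 0, 2, 0, 1, 0, 3, 0, 1, 0, 2, 0, 1] := by
  have h : takeInf ruler 14 = [0, 1, 0, 2, 0, 1, 0, 3, 0, 1, 0, 2, 0, 1] := by decide +kernel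
  rw [← h]
  refine P0_eq_of_forced (x := 2) (by decide +kernel) ?_ ?_ <;> rw [h]
  · exact sqFree_of_sqFreeTest (by decide +kernel)
  · exact forced_of_forcedTest (P := [1, 2, 3, 4, 5, 6, 7, 8]) (v := [3]) (by decide +kernel)

theorem psi1_one : psi1 1 = [2, 0, 1, 0, 2, 0, 1] := by rw [psi1, P0_two]

theorem psi1_two : psi1 2 = [3, 0, 1, 0, 2, 0, 1, 0, 3, 0, 1, 0, 2, 0, 1] := by
  rw [psi1, P0_three]

theorem psi2_one : psi2 1 = psi1 2 ++ (psi1 0 ++ psi1 1 ++ psi1 0 ++ psi1 2 ++ psi1 0 ++ psi1 1) := by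
  simp [psi2, P1, P0_two, mapList, psi1]

/-- The word `psi2 0`. -/
def psi2Zero : List ℕ :=
    [
      2, 0, 2, 1, 0, 2, 0, 1, 0, 2, 1, 0, 1, 2, 0, 1, 0, 2, 0, 1, 2, 0, 2, 1, 0,
      1, 2, 0, 1, 0, 2, 0, 1, 3, 0, 1, 0, 2, 0, 1, 0, 3, 0, 1, 0, 2, 0, 1, 2, 0,
      2, 1, 0, 1, 2, 0, 1, 0, 2, 0, 1, 2, 0, 2, 1, 0, 1, 3, 0, 1, 0, 2, 0, 1, 0,
      3, 0, 1, 0, 2, 0, 1, 2, 0, 2, 1, 0, 1, 2, 0, 1, 0, 2, 0, 1, 2, 0, 2, 3, 0,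
      1, 0, 2, 0, 1, 0, 3, 0, 1, 0, 2, 0, 1, 2, 0, 2, 1, 0, 1, 2, 0, 1, 0, 2, 0,
      1, 2, 0, 3, 0, 1, 0, 2, 0, 1, 0, 3, 0, 1, 0, 2, 0, 3, 0, 1, 0, 3, 0, 2, 0,
      1, 0, 2, 0, 3, 0, 1, 0, 2, 0, 1, 0, 3, 0, 1, 0, 2, 0, 3, 0, 1, 0, 3, 0, 2,
      0, 1, 2, 0, 2, 1, 0, 1, 2, 0, 1, 0, 2, 0, 1, 2, 0, 2, 1, 0, 1, 2, 0, 2]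

theorem psi2_zero : psi2 0 = psi2Zero := rfl

theorem psi1_zero : psi1 0 = [2, 0, 2, 1, 0, 1] := rfl

/-- An explicit form of the word `B0`, without reference to the words `P0 n`. -/
def b0 : List ℕ :=
  let x₀ := [2, 0, 2, 1, 0, 1]
  let x₁ := [2, 0, 1, 0, 2, 0, 1]
  let x₂ := [3, 0, 1, 0, 2, 0, 1, 0, 3, 0, 1, 0, 2, 0, 1]
  let y₁ := x₂ ++ (x₀ ++ x₁ ++ x₀ ++ x₂ ++ x₀ ++ x₁)
  let y₀ := psi2Zero
  [0, 3, 0, 1] ++ (x₁ ++ x₀ ++ x₁ ++ x₀).rdrop 3 ++ (y₁ ++ y₀ ++ y₁ ++ y₀).rdrop 6 ++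
    (y₁ ++ y₀).rdrop 12 ++ [3, 0, 1, 0, 2, 0]

theorem B0_eq : B0 = b0 := by
  simp only [B0, b0, mapList, List.flatMap_cons, List.flatMap_nil, List.append_nil, psi1_one,
    psi2_one, psi1_two, psi2_zero, psi1_zero, List.append_assoc]

/-- An explicit form of the word `B1`. -/
def b1 : List ℕ := mapList rho ((b0.drop 7).rdrop 5)

/-- An explicit form of the word `E`. -/
def e : List ℕ := [0, 1, 0, 2] ++ b0 ++ [1] ++ b0.rdrop 9

/-- An explicit form of the word `F`. -/
def f : List ℕ :=
  b0.rtake 9 ++ [3, 0, 1, 0, 3, 0, 2] ++ C ++ [0, 1, 0, 3] ++ plus C ++ [0, 2]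

theorem B1_eq : B1 = b1 := by rw [B1, B0_eq, b1]

theorem E_eq : E = e := by rw [E, B0_eq, e]

theorem F_eq : F = f := by rw [F, B0_eq, f]

/-! ### Ruler words -/

theorem plus_concat (w : List ℕ) (a : ℕ) : plus (w ++ [a]) = w ++ [a + 1] := by
  simp [plus]

@[simp] theorem length_plus {w : List ℕ} (hw : w ≠ []) : (plus w).length = w.length := by
  have := List.length_pos_iff.mpr hw
  simp [plus]; omega

theorem plus_append {w x : List ℕ} (hx : x ≠ []) : plus (w ++ x) = w ++ plus x := by
  rw [← List.dropLast_append_getLast hx, ← List.append_assoc, plus_concat, plus_concat,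
    List.append_assoc]

theorem mapList_rho_plus {w : List ℕ} (hw : w ≠ []) :
    mapList rho (plus w) = plus (mapList rho w) := by
  rw [← List.dropLast_append_getLast hw, plus_concat, mapList_append, mapList_append,
    mapList_singleton, mapList_singleton, plus_append (by simp [rho])]
  rfl

theorem R_succ_eq_mapList (k : ℕ) : R (k + 1) = mapList rho (R k) :=
  Function.iterate_succ_apply' _ _ _

theorem length_mapList_rho (w : List ℕ) : (mapList rho w).length = 2 * w.length := by
  induction w with
  | nil => rfl
  | cons x xs ih =>
    rw [show mapList rho (x :: xs) = 0 :: (x + 1) :: mapList rho xs from rfl]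
    simp [ih]; omega

@[simp] theorem length_R (k : ℕ) : (R k).length = 2 ^ k := by
  induction k with
  | zero => rfl
  | succ k ih => rw [R_succ_eq_mapList, length_mapList_rho, ih]; ring

theorem R_ne_nil (k : ℕ) : R k ≠ [] := by
  rw [← List.length_pos_iff, length_R]; positivity

theorem R_succ (k : ℕ) : R (k + 1) = R k ++ plus (R k) := by
  induction k with
  | zero => rfl
  | succ k ih =>
    rw [R_succ_eq_mapList (k + 1), ih, mapList_append, mapList_rho_plus (R_ne_nil k),
      ← R_succ_eq_mapList, ← ih]

theorem R_eq_dropLast_append (k : ℕ) : R k = (R k).dropLast ++ [k] := by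
  induction k with
  | zero => rfl
  | succ k ih =>
    have h : R (k + 1) = (R k ++ (R k).dropLast) ++ [k + 1] := by
      rw [R_succ]
      conv_lhs => rw [ih]
      rw [plus_concat, ← List.append_assoc, ← ih]
    conv_rhs => rw [h, List.dropLast_concat]
    exact h

theorem forced_R (w : List ℕ) (k : ℕ) : Forced w (R k) := by
  refine Forced.of_nil ?_ w
  induction k with
  | zero => exact forced_singleton.mpr fun c hc => absurd hc (Nat.not_lt_zero c)
  | succ k ih =>
    have h := R_eq_dropLast_append k
    have ih' := ih
    rw [h, forced_append] at ih'
    rw [R_succ, forced_append]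
    refine ⟨ih, ?_⟩
    rw [h, plus_concat, ← h, forced_append]
    refine ⟨ih'.1.of_nil _, forced_singleton.mpr fun c hc => ?_⟩
    rcases Nat.lt_or_eq_of_le (Nat.le_of_lt_succ hc) with h1 | rfl
    · exact (forced_singleton.mp ih'.2 c h1).append_left _
    · exact ⟨R c, R_ne_nil c, by rw [List.append_assoc, List.nil_append, ← h]⟩

/-- The exponent of `2` in `i`, cut off at `K`. For `i ≥ 1` these are the letters of the infinite
repetition of `R K`. -/
def cap (K i : ℕ) : ℕ := min (padicValNat 2 i) K

theorem le_cap_iff {K m i : ℕ} (hi : 0 < i) (hm : m ≤ K) : m ≤ cap K i ↔ 2 ^ m ∣ i := by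
  rw [cap, le_min_iff, padicValNat_dvd_iff_le hi.ne']
  simp [hm]

theorem cap_eq_of_dvd_iff {K L i j : ℕ} (hi : 0 < i) (hj : 0 < j) (hK : cap K i ≤ L)
    (hL : cap L j ≤ K) (h : ∀ m, m ≤ K → m ≤ L → (2 ^ m ∣ i ↔ 2 ^ m ∣ j)) :
    cap K i = cap L j := by
  have h1 : cap K i ≤ K := min_le_right _ _
  have h2 : cap L j ≤ L := min_le_right _ _
  apply le_antisymm
  · rw [le_cap_iff hj hK, ← h _ h1 hK, ← le_cap_iff hi h1]
  · rw [le_cap_iff hi hL, h _ hL h2, ← le_cap_iff hj h2]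

theorem cap_add_mul {K i : ℕ} (hi : 0 < i) (m : ℕ) : cap K (m * 2 ^ K + i) = cap K i := by
  refine cap_eq_of_dvd_iff (by omega) hi (min_le_right _ _) (min_le_right _ _) fun a ha _ => ?_
  exact Nat.dvd_add_right ((pow_dvd_pow 2 ha).mul_left m)

theorem cap_odd (K i : ℕ) : cap K (2 * i + 1) = 0 := by
  by_contra h
  have h1 : 1 ≤ cap K (2 * i + 1) := by omega
  rw [le_cap_iff (by omega) (h1.trans (min_le_right _ _))] at h1
  omega

theorem cap_succ_two_mul (K : ℕ) {i : ℕ} (hi : 0 < i) : cap (K + 1) (2 * i) = cap K i + 1 := by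
  rw [cap, cap, padicValNat.mul (by omega) (by omega), padicValNat_self, ← Nat.add_min_add_right]
  congr 1; omega

/-- A square of period `p = 2 ^ m * q`, with `q` odd and `m < K`, is impossible: among the first
`2 ^ m` positions one is a multiple of `2 ^ m`, and exactly one of this position and its
translate by `p` is a multiple of `2 ^ (m + 1)`. -/
theorem not_isSq_cap {K i p : ℕ} (hi : 0 < i) (hp : p < 2 ^ K) : ¬ IsSq (cap K) i p := by
  intro h
  obtain ⟨m, q, hq, rfl⟩ := Nat.exists_eq_two_pow_mul_odd h.1.ne'
  have hm : m < K := by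
    refine (Nat.pow_lt_pow_iff_right (a := 2) (by omega)).mp (lt_of_le_of_lt ?_ hp)
    exact Nat.le_mul_of_pos_right _ hq.pos
  have hpm : 0 < 2 ^ m := by positivity
  obtain ⟨a, ha, c, hc⟩ : ∃ a < 2 ^ m, 2 ^ m ∣ i + a := by
    refine ⟨(2 ^ m - i % 2 ^ m) % 2 ^ m, Nat.mod_lt _ hpm, ?_⟩
    rw [Nat.dvd_iff_mod_eq_zero, Nat.add_mod, Nat.mod_mod]
    have h1 := Nat.mod_lt i hpm
    rcases Nat.eq_zero_or_pos (i % 2 ^ m) with h2 | h2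
    · simp [h2]
    · rw [Nat.mod_eq_of_lt (a := 2 ^ m - i % 2 ^ m) (by omega), Nat.add_sub_cancel' h1.le,
        Nat.mod_self]
  have h1 := h.2 a (lt_of_lt_of_le ha (Nat.le_mul_of_pos_right _ hq.pos))
  have h2 : m + 1 ≤ cap K (i + a) ↔ m + 1 ≤ cap K (i + 2 ^ m * q + a) := by rw [h1]
  rw [le_cap_iff (by omega) hm, le_cap_iff (by omega) hm, show i + 2 ^ m * q + a =
    2 ^ m * (c + q) by rw [Nat.mul_add, ← hc]; ring, hc, pow_succ,
    Nat.mul_dvd_mul_iff_left hpm, Nat.mul_dvd_mul_iff_left hpm] at h2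
  obtain ⟨r, rfl⟩ := hq
  omega

/-- The factor of length `n` at position `a` of the sequence `cap K`. -/
def capWord (K a n : ℕ) : List ℕ := (List.range n).map fun i => cap K (a + i)

@[simp] theorem length_capWord (K a n : ℕ) : (capWord K a n).length = n := by simp [capWord]

@[simp] theorem getElem_capWord (K a n j : ℕ) (h : j < (capWord K a n).length) :
    (capWord K a n)[j] = cap K (a + j) := by simp [capWord]

theorem capWord_add (K a m n : ℕ) :
    capWord K a (m + n) = capWord K a m ++ capWord K (a + m) n := by
  simp [capWord, List.range_add, Function.comp_def, Nat.add_assoc]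

theorem drop_capWord (K a m n : ℕ) : (capWord K a (m + n)).drop m = capWord K (a + m) n := by
  rw [capWord_add, List.drop_left' (by simp)]

theorem mapList_rho_capWord (K n : ℕ) :
    mapList rho (capWord K 1 n) = capWord (K + 1) 1 (2 * n) := by
  induction n with
  | zero => rfl
  | succ n ih =>
    rw [capWord_add, mapList_append, ih, Nat.mul_add, capWord_add]
    congr 1
    simp only [capWord, List.map_cons, List.map_nil, mapList_singleton, rho,
      List.range_succ, List.range_zero, Nat.add_zero, List.nil_append,
      List.cons_append, Nat.mul_one]
    rw [Nat.add_comm 1 (2 * n), cap_odd, show 2 * n + 1 + 1 = 2 * (1 + n) by omega,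
      cap_succ_two_mul _ (by omega)]

theorem R_eq_capWord (k : ℕ) : R k = capWord k 1 (2 ^ k) := by
  induction k with
  | zero => decide +kernel
  | succ k ih => rw [R_succ_eq_mapList, ih, mapList_rho_capWord, pow_succ']

theorem capWord_add_mul (K m n : ℕ) {a : ℕ} (ha : 0 < a) :
    capWord K (m * 2 ^ K + a) n = capWord K a n :=
  List.map_congr_left fun i _ => by rw [Nat.add_assoc, cap_add_mul (by omega)]

theorem R_append_R (k : ℕ) : R k ++ R k = capWord k 1 (2 ^ (k + 1)) := by
  rw [pow_succ, Nat.mul_two, capWord_add, Nat.add_comm 1, R_eq_capWord]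
  congr 1
  simpa using (capWord_add_mul k 1 (2 ^ k) (a := 1) (by omega)).symm

/-- The words `R (j + 4) ++ R (j + 4)` without the first `16` letters: these are the pieces of the
words `alpha n` between the factors `C ++ B1`. -/
def q (j : ℕ) : List ℕ := (R (j + 4) ++ R (j + 4)).drop 16

theorem sixteen_le (j : ℕ) : 16 ≤ 2 ^ (j + 4) := by
  rw [pow_add]; have : 0 < 2 ^ j := by positivity
  omega

theorem q_eq_append (j : ℕ) : q j = (R (j + 4)).drop 16 ++ R (j + 4) := by
  rw [q, List.drop_append_of_le_length (by rw [length_R]; exact sixteen_le j)]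

theorem q_zero : q 0 = R 4 := by decide +kernel

theorem length_q (j : ℕ) : (q j).length + 16 = 2 ^ (j + 5) := by
  have := sixteen_le j
  rw [q, List.length_drop, List.length_append, length_R, pow_succ 2 (j + 4)]
  omega

theorem q_ne_nil (j : ℕ) : q j ≠ [] := by
  rw [q_eq_append]; simp [R_ne_nil]

theorem q_eq_capWord (j : ℕ) : q j = capWord (j + 4) 17 (q j).length := by
  have h : q j = (capWord (j + 4) 1 (16 + (q j).length)).drop 16 := by
    rw [Nat.add_comm 16, length_q, ← R_append_R, q]
  conv_lhs => rw [h]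
  rw [drop_capWord]

theorem q_succ (j : ℕ) : q (j + 1) = plus (q j) ++ R (j + 5) := by
  rw [q_eq_append, q_eq_append, plus_append (R_ne_nil _), show j + 1 + 4 = j + 4 + 1 by omega,
    R_succ, List.drop_append_of_le_length (by rw [length_R]; exact sixteen_le j), R_succ]

theorem q_eq_dropLast_append (j : ℕ) : q j = (q j).dropLast ++ [j + 4] := by
  rw [q_eq_append, List.dropLast_append_of_ne_nil (R_ne_nil _), List.append_assoc,
    ← R_eq_dropLast_append]

theorem getLast?_q (j : ℕ) : (q j).getLast? = some (j + 4) := by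
  rw [q_eq_dropLast_append]; simp

theorem isPrefix_dropLast {x y : List ℕ} (h : x <+: y) (hl : x.length < y.length) :
    x <+: y.dropLast := by
  rw [List.dropLast_eq_take]
  exact List.prefix_take_iff.mpr ⟨h, by omega⟩

theorem isPrefix_plus {x y : List ℕ} (h : x <+: y) (hl : x.length < y.length) :
    x <+: plus y :=
  (isPrefix_dropLast h hl).trans (List.prefix_append _ _)

/-- Words `γ n` of increasing lengths form a prefix code if the successor of each of them is a
prefix of the next one. -/
theorem eq_of_isPrefix_of_plus {γ : ℕ → List ℕ} (hne : ∀ n, γ n ≠ [])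
    (hlen : ∀ n, (γ n).length < (γ (n + 1)).length) (hplus : ∀ n, plus (γ n) <+: γ (n + 1))
    (m n : ℕ) (h : γ m <+: γ n) : m = n := by
  have hmono : StrictMono fun n => (γ n).length := strictMono_nat_of_lt_succ hlen
  rcases Nat.lt_trichotomy m n with h1 | h1 | h1
  · exfalso
    have h2 : ∀ n, m < n → plus (γ m) <+: γ n := by
      intro n
      induction n with
      | zero => intro h; omega
      | succ n ih =>
        intro h3
        rcases Nat.lt_or_eq_of_le (Nat.le_of_lt_succ h3) with h4 | rfl
        · refine (isPrefix_plus (ih h4) ?_).trans (hplus n)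
          rw [length_plus (hne m)]
          exact hmono h4
        · exact hplus m
    have h3 : γ m = plus (γ m) :=
      (List.prefix_of_prefix_length_le h (h2 n h1) (by rw [length_plus (hne m)])).eq_of_length
        (by rw [length_plus (hne m)])
    rw [← List.dropLast_append_getLast (hne m), plus_concat] at h3
    simp at h3
  · exact h1
  · have h2 : (γ n).length < (γ m).length := hmono h1
    have := h.length_le
    omega

theorem q_prefix_free (m n : ℕ) (h : q m <+: q n) : m = n := by
  refine eq_of_isPrefix_of_plus q_ne_nil (fun n => ?_) (fun n => ?_) m n h
  · rw [q_succ, List.length_append, length_plus (q_ne_nil n)]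
    have := List.length_pos_iff.mpr (R_ne_nil (n + 5))
    omega
  · rw [q_succ]; exact List.prefix_append _ _

theorem head_isPrefix_q (j : ℕ) : (R 4).dropLast ++ [5] <+: q (j + 1) := by
  induction j with
  | zero => decide +kernel
  | succ j ih =>
    rw [q_succ]
    refine (isPrefix_plus ih ?_).trans (List.prefix_append _ _)
    have h1 := length_q (j + 1)
    have h2 := sixteen_le j
    rw [show j + 1 + 5 = j + 4 + 2 by omega, pow_add] at h1
    simp; omega

theorem not_isInfix_q (j : ℕ) : ¬ [2, 0, 3] <:+: q j := by
  rintro ⟨x, y, h⟩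
  rw [q_eq_capWord] at h
  have hl := congrArg List.length h
  simp only [List.length_append, List.length_cons, List.length_nil, length_capWord] at hl
  have h1 : (capWord (j + 4) 17 (q j).length)[x.length]? = some 2 := by rw [← h]; simp
  have h2 : (capWord (j + 4) 17 (q j).length)[x.length + 2]? = some 3 := by rw [← h]; simp
  rw [List.getElem?_eq_getElem (by simp; omega), Option.some.injEq, getElem_capWord] at h1 h2
  have h3 := (le_cap_iff (K := j + 4) (m := 1) (i := 17 + x.length) (by omega) (by omega)).mp
    (by omega)
  have h4 := (le_cap_iff (K := j + 4) (m := 2) (i := 17 + x.length) (by omega) (by omega)).mp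
    (by omega)
  have h5 := (le_cap_iff (K := j + 4) (m := 2) (i := 17 + (x.length + 2)) (by omega)
    (by omega)).mp (by omega)
  omega

theorem not_isInfix_mapList_rho (x : List ℕ) : ¬ [1, 2] <:+: mapList rho x := by
  induction x with
  | nil => simp [mapList]
  | cons a x ih =>
    rw [show mapList rho (a :: x) = 0 :: (a + 1) :: mapList rho x from rfl,
      List.infix_cons_iff, List.infix_cons_iff]
    rintro (h | h | h)
    · simp at h
    · cases x with
      | nil => simp [mapList] at h
      | cons b x =>
        rw [show mapList rho (b :: x) = 0 :: (b + 1) :: mapList rho x from rfl] at h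
        simp at h
    · exact ih h

/-! ### Images of nonzero letters are square-free -/

theorem cap_eq_cap {K L i : ℕ} (hi : 0 < i) (hLK : L ≤ K) (h : i < 2 ^ (L + 1)) :
    cap K i = cap L i := by
  refine cap_eq_of_dvd_iff hi hi ?_ ((min_le_right _ _).trans hLK) fun _ _ _ => Iff.rfl
  by_contra hlt
  have h1 : L + 1 ≤ cap K i := by omega
  rw [le_cap_iff hi (h1.trans (min_le_right _ _))] at h1
  exact absurd (Nat.le_of_dvd hi h1) (by omega)

theorem capWord_eq_R_four (j : ℕ) : capWord (j + 4) 1 16 = R 4 := by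
  rw [R_eq_capWord]
  refine List.map_congr_left fun i hi => ?_
  have := List.mem_range.mp hi
  exact cap_eq_cap (by omega) (by omega) (by omega)

theorem take_R_four (j n : ℕ) (hn : n ≤ 16) : (R 4).take n = capWord (j + 4) 1 n := by
  obtain ⟨m, hm⟩ := Nat.exists_eq_add_of_le hn
  rw [← capWord_eq_R_four j, hm, capWord_add, List.take_left' (by simp)]

/-- A piece `q j`, with the end of `R 4` before it and a beginning of `R 4` after it, is a factor
of the infinite repetition of `R (j + 4)`. -/
theorem drop_append_q_append_take (j n : ℕ) (hn : n ≤ 16) :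
    (R 4).drop 6 ++ q j ++ (R 4).take n = capWord (j + 4) 7 (10 + (q j).length + n) := by
  have hq := length_q j
  have h2 : 2 ^ (j + 5) = 2 * 2 ^ (j + 4) := pow_succ' 2 (j + 4)
  rw [capWord_add, capWord_add, take_R_four j n hn]
  congr 1
  · rw [← q_eq_capWord]
    congr 1
    rw [← capWord_eq_R_four j, show 16 = 6 + 10 from rfl, drop_capWord]
  · rw [show 7 + (10 + (q j).length) = 2 * 2 ^ (j + 4) + 1 by omega,
      capWord_add_mul _ _ _ (by omega)]

/-- The blocks of which the words `C ++ alpha n` are composed. -/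
def block (j : ℕ) : List ℕ := C ++ b1 ++ q j

theorem block_ne_nil (j : ℕ) : block j ≠ [] := by simp [block, C]

/-- Raising the last letter of a word of blocks from `n` to `n + 1` turns the piece `q n` at the end
into `q (n + 1) = plus (q n) ++ R (n + 5)`. -/
theorem mapList_block_plus (n : ℕ) :
    mapList block (plus (R n)) = plus (mapList block (R n)) ++ R (n + 5) := by
  conv_lhs => rw [R_eq_dropLast_append n, plus_concat]
  conv_rhs => rw [R_eq_dropLast_append n]
  rw [mapList_append, mapList_append, mapList_singleton, mapList_singleton,
    plus_append (block_ne_nil _), block, block, plus_append (q_ne_nil _), q_succ]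
  simp only [List.append_assoc]

theorem alpha_ne_nil (n : ℕ) : alpha n ≠ [] := by
  match n with
  | 0 => simp [alpha, E]
  | 1 => simp [alpha, C]
  | n + 2 => simp [alpha, C]

/-- The recursion `R (n + 1) = R n ++ plus (R n)` matches the recursion for `alpha`. -/
theorem C_append_alpha (n : ℕ) : C ++ alpha (n + 1) = mapList block (R n ++ R n) := by
  induction n with
  | zero =>
    rw [show R 0 = [0] from rfl, mapList_append, mapList_singleton, block, q_zero, alpha, B1_eq]
    simp only [List.append_assoc]
  | succ n ih =>
    have h : C ++ (plus (alpha (n + 1)) ++ R (n + 5)) = mapList block (R (n + 1)) := by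
      rw [← List.append_assoc, ← plus_append (alpha_ne_nil _), ih, mapList_append,
        plus_append, List.append_assoc, ← mapList_block_plus, R_succ, mapList_append]
      intro h
      rw [R_eq_dropLast_append, mapList_append, mapList_singleton] at h
      exact block_ne_nil _ (List.append_eq_nil_iff.mp h).2
    rw [mapList_append, ← h, alpha]
    simp only [List.append_assoc]

/-- The pieces `q j` separated by `C ++ B1`. Here `R 4` without its last letter precedes the first
letter `5` of every piece but `q 0`, and the factor `203`, which is foreign to the ruler sequence,
occurs in `C` and near the end of `B1`. -/
theorem separated_q :
    Separated (C ++ b1) (R 4).dropLast [2, 0, 3] q 5 3 11 where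
  sep_lt := by decide +kernel
  zero_lt := by decide +kernel
  head_lt := by decide +kernel
  exists_head n hn := by
    obtain ⟨m, rfl⟩ := Nat.exists_eq_succ_of_ne_zero hn
    exact ⟨5, le_rfl, head_isPrefix_q m⟩
  exists_last n hn := ⟨n + 4, by omega, getLast?_q n⟩
  ne_nil := q_ne_nil
  prefix_free := q_prefix_free
  last_inj m n h := by
    rw [getLast?_q, getLast?_q, Option.some.injEq] at h
    omega
  sqFree := sqFree_of_sqFreeTest (by decide +kernel)
  eq_of_prefix_drop g hg := by
    have := eq_of_occursTest (m := (C ++ b1 ++ q 0).length) (g := 0) (by simp [C])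
      (by decide +kernel) hg
    simpa using this
  mark_ne_nil := by simp
  not_isInfix_mark n _ := not_isInfix_q n
  mark_left := by decide +kernel
  mark_right := by decide +kernel
  le_length := by decide +kernel

theorem pos_add_of_periodic {b : ℕ → List ℕ} {u : ℕ → ℕ} {P : ℕ} (h : ∀ k, u (k + P) = u k)
    (k : ℕ) : pos b u (k + P) = pos b u k + pos b u P := by
  induction k with
  | zero => simp
  | succ k ih => rw [show k + 1 + P = k + P + 1 by omega, pos_succ, pos_succ, ih, h]; omega

/-- For `alpha 1` the sequence of pieces is `q 0, q 0`, in which zeros do not alternate with other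
letters, so that this word is tested separately. -/
theorem sqFree_alpha_one : SqFree ([2] ++ alpha 1 ++ [0, 1, 0, 2, 0, 3, 0, 1]) := by
  rw [alpha, B1_eq]
  exact sqFree_of_sqFreeTest (by decide +kernel)

theorem sqFree_of_occursAt {X : List ℕ} {s : ℕ → ℕ} {g : ℕ} (h : OccursAt X (inf s) g)
    (hs : ∀ i p, IsSq s i p → g ≤ i → g + X.length < i + 2 * p) : SqFree X := by
  intro i p hi
  by_contra hle
  rw [occursAt_inf_iff] at h
  have := hs (g + i) p (hi.congr fun a ha => by
    rw [List.getD_eq_getElem _ _ (by omega), ← h _ (by omega)]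
    congr 1; omega) (by omega)
  omega

/-- The image of a nonzero letter is square-free, even together with the letters `2` before it and
`01020301` after it that it is given by images of `0`. One more letter `0` on either side would
complete a square whose period is half of `C ++ alpha n`. -/
theorem sqFree_alpha (n : ℕ) : SqFree ([2] ++ alpha (n + 1) ++ [0, 1, 0, 2, 0, 3, 0, 1]) := by
  rcases n with _ | m
  · exact sqFree_alpha_one
  have hA := C_append_alpha (m + 1)
  generalize alpha (m + 1 + 1) = A at hA ⊢
  let v : ℕ → ℕ := fun k => cap (m + 1) (k + 1)
  have hv : ∀ k, v k = 0 ↔ Even k := by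
    intro k
    have h := le_cap_iff (K := m + 1) (m := 1) (i := k + 1) (by omega) (by omega)
    simp only [v]
    rw [Nat.even_iff]
    omega
  have hper : ∀ k, v (k + 2 ^ (m + 1)) = v k := by
    intro k
    have := cap_add_mul (K := m + 1) (i := k + 1) (by omega) 1
    simp only [v]
    rw [← this]
    congr 1; omega
  -- The first period of `v` is `R (m + 1)`.
  have htake : takeInf v (2 ^ (m + 1) + 2 ^ (m + 1)) = R (m + 1) ++ R (m + 1) := by
    rw [R_append_R, pow_succ 2 (m + 1), Nat.mul_two, takeInf, capWord]
    exact List.map_congr_left fun i _ => by simp only [v, Nat.add_comm]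
  have hpos := pos_add_of_periodic (b := block) hper (2 ^ (m + 1))
  have hlen : pos block v (2 ^ (m + 1) + 2 ^ (m + 1)) = 10 + A.length := by
    rw [pos, htake, ← hA, List.length_append]; rfl
  have hocc : OccursAt ([2] ++ A ++ [0, 1, 0, 2, 0, 3, 0, 1])
      (inf (cat block v)) 9 := by
    have h1 := occursAt_takeInf (cat block v) (pos block v (2 ^ (m + 1) + 2 ^ (m + 1)))
    rw [takeInf_cat block_ne_nil, htake, ← hA] at h1
    have h2 := (separated_q.occursAt_sep (u := v) (2 ^ (m + 1) + 2 ^ (m + 1))).of_isPrefix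
      (x := [0, 1, 0, 2, 0, 3, 0, 1]) (by decide +kernel)
    change OccursAt _ (inf (cat block v)) (pos block v _) at h2
    rw [hlen] at h2
    have h3 : OccursAt (C ++ A ++ [0, 1, 0, 2, 0, 3, 0, 1]) (inf (cat block v)) 0 :=
      occursAt_append.mpr ⟨h1, by
        rwa [Nat.zero_add, List.length_append, show C.length = 10 from rfl]⟩
    have h4 := h3.drop (o := 9) (by simp [C])
    simpa [C] using h4
  refine sqFree_of_occursAt hocc fun i p hs hi => ?_
  simp only [List.length_append, List.length_cons, List.length_nil]
  -- A square of blocks has a multiple of `2 ^ (m + 1)` as its period, and is too long. A square near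
  -- a single piece would give a short square in the infinite repetition of a word `R K`, since
  -- `C ++ B1` ends with the last `10` letters of `R 4`, and begins with its first `5` letters.
  rcases separated_q.isSq_cases hv hs with ⟨k, t, ht, hkt⟩ | ⟨k, -, h1, h2⟩
  · change pos block v (k + t) = pos block v k + p at hkt
    have h3 : 2 ^ (m + 1) ≤ t := by
      by_contra hlt
      refine not_isSq_cap (K := m + 1) (i := k + 1) (p := t) (by omega) (by omega)
        (ht.congr fun a _ => ?_)
      simp only [v]; congr 1; omega
    have h4 := (pos_strictMono block_ne_nil v).monotone (Nat.add_le_add_left h3 k)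
    have h5 := pos_add_of_periodic (b := block) hper k
    omega
  · exfalso
    change pos block v k + (C ++ b1).length < i + 11 at h1
    change i + 2 * p < pos block v (k + 1) + 3 + 3 at h2
    have hD : (C ++ b1).length = 1582 := by decide +kernel
    have h3 := ((separated_q.occursAt_sep (u := v) k).drop (o := 1572) (by omega))
    have h4 := separated_q.occursAt_content (u := v) k
    have h5 := (separated_q.occursAt_sep (u := v) (k + 1)).of_isPrefix
      (x := (R 4).take 5) (by decide +kernel)
    rw [show (C ++ b1).drop 1572 = (R 4).drop 6 by decide +kernel] at h3
    change OccursAt _ (inf (cat block v)) (pos block v k + 1572) at h3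
    change OccursAt _ (inf (cat block v)) (pos block v k + (C ++ b1).length) at h4
    change OccursAt _ (inf (cat block v)) (pos block v (k + 1)) at h5
    have hk : pos block v (k + 1) = pos block v k + 1582 + (q (v k)).length := by
      rw [pos_succ, block, List.length_append, hD]; omega
    have h6 : OccursAt ((R 4).drop 6 ++ q (v k) ++ (R 4).take 5) (inf (cat block v))
        (pos block v k + 1572) := by
      rw [occursAt_append, occursAt_append]
      have hT : ((R 4).drop 6).length = 10 := by rw [List.length_drop, length_R]; norm_num
      refine ⟨⟨h3, ?_⟩, ?_⟩
      · rw [hD] at h4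
        rwa [hT]
      · rw [hk] at h5
        rwa [List.length_append, hT, show pos block v k + 1572 + (10 + (q (v k)).length) =
          pos block v k + 1582 + (q (v k)).length by omega]
    have hq := length_q (v k)
    rw [pow_succ] at hq
    rw [drop_append_q_append_take _ _ (by omega), occursAt_inf_iff] at h6
    refine not_isSq_cap (K := v k + 4) (i := 7 + (i - (pos block v k + 1572))) (p := p) (by omega)
      (by omega) (hs.congr fun a ha => ?_)
    have h7 := h6 (i - (pos block v k + 1572) + a) (by simp; omega)
    rw [getElem_capWord] at h7
    rw [Nat.add_assoc 7, ← h7]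
    change cat block v _ = _
    congr 1; omega

/-! ### Images of even-grounded words are square-free -/

theorem SqFree.of_isPrefix {x y : List ℕ} (h : SqFree y) (hx : x <+: y) : SqFree x := by
  intro i p hi
  by_contra hle
  push Not at hle
  have := h i p (hi.congr fun a ha => by
    rw [List.getD_eq_getElem _ _ (by omega),
      List.getD_eq_getElem _ _ (by have := hx.length_le; omega), hx.getElem])
  have := hx.length_le
  omega

/-- The words that stand between the copies of `E` in a product of images of letters. -/
noncomputable def content : ℕ → List ℕ
  | 0 => f
  | n + 1 => alpha (n + 1)

/-- The images of nonzero letters are images of the ruler morphism. -/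
theorem exists_mapList_rho (n : ℕ) : ∃ x, x ≠ [] ∧ alpha (n + 1) = mapList rho x := by
  induction n with
  | zero =>
    refine ⟨(b0.drop 7).rdrop 5 ++ R 3 ++ [0, 1, 2, 0, 1] ++ (b0.drop 7).rdrop 5 ++ R 3,
      by simp, ?_⟩
    simp only [mapList_append, alpha, B1_eq, b1, R_succ_eq_mapList 3]
    rfl
  | succ n ih =>
    obtain ⟨x, hx, h⟩ := ih
    refine ⟨plus x ++ R (n + 4) ++ [0, 1, 2, 0, 1] ++ plus x ++ R (n + 4), by simp, ?_⟩
    simp only [mapList_append, mapList_rho_plus hx, alpha, h, R_succ_eq_mapList (n + 4)]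
    rfl

theorem exists_alpha_eq (n : ℕ) : ∃ Y, alpha (n + 1) = Y ++ b1 ++ q n := by
  induction n with
  | zero => exact ⟨b1 ++ R 4 ++ C, by rw [alpha, B1_eq, q_zero]⟩
  | succ n ih =>
    obtain ⟨Y, hY⟩ := ih
    refine ⟨plus (alpha (n + 1)) ++ R (n + 5) ++ C ++ Y, ?_⟩
    rw [q_succ, alpha]
    conv_lhs => rw [hY]
    rw [hY, plus_append (q_ne_nil n)]
    simp only [List.append_assoc]

theorem alpha_eq_dropLast_append (n : ℕ) :
    alpha (n + 1) = (alpha (n + 1)).dropLast ++ [n + 4] := by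
  obtain ⟨Y, hY⟩ := exists_alpha_eq n
  rw [q_eq_dropLast_append n, ← List.append_assoc] at hY
  rw [hY, List.dropLast_concat]

theorem getLast?_alpha (n : ℕ) : (alpha (n + 1)).getLast? = some (n + 4) := by
  rw [alpha_eq_dropLast_append]; simp

theorem length_alpha_lt (n : ℕ) : (alpha (n + 1)).length < (alpha (n + 2)).length := by
  have := List.length_pos_iff.mpr (R_ne_nil (n + 5))
  rw [alpha]
  simp only [List.length_append, length_plus (alpha_ne_nil _)]
  omega

theorem plus_alpha_isPrefix (n : ℕ) : plus (alpha (n + 1)) <+: alpha (n + 2) := by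
  rw [alpha]
  simp only [List.append_assoc]
  exact List.prefix_append _ _

theorem b1_isPrefix_alpha (n : ℕ) : b1.take 42 <+: alpha (n + 1) ∧ 42 < (alpha (n + 1)).length := by
  induction n with
  | zero =>
    rw [alpha, B1_eq]
    exact ⟨by decide +kernel, by decide +kernel⟩
  | succ n ih =>
    refine ⟨(isPrefix_plus ih.1 ?_).trans (plus_alpha_isPrefix n), ih.2.trans (length_alpha_lt n)⟩
    rw [List.length_take]; omega

theorem content_prefix_free (m n : ℕ) (h : content m <+: content n) : m = n := by
  have hf : f.length = 42 := by decide +kernel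
  rcases m with _ | m <;> rcases n with _ | n
  · rfl
  · have h1 := (List.prefix_of_prefix_length_le (b1_isPrefix_alpha n).1 h
      (by rw [content, hf, List.length_take]; omega)).eq_of_length (by decide +kernel)
    exact absurd h1 (by decide +kernel)
  · have h1 : (alpha (m + 1)).length ≤ f.length := h.length_le
    have := (b1_isPrefix_alpha m).2
    omega
  · rw [eq_of_isPrefix_of_plus (γ := fun n => alpha (n + 1)) (fun n => alpha_ne_nil _)
      length_alpha_lt plus_alpha_isPrefix m n h]

theorem getLast?_f : f.getLast? = some 2 := by decide +kernel

/-- The words `content n` separated by `E`. Here the first letter `4` of `B1` is at position `41`,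
and the factor `12`, which is not even-grounded, occurs at position `7` and at the end of `E`. -/
theorem separated_content : Separated e (b1.take 41) [1, 2] content 4 7 2 where
  sep_lt := by decide +kernel
  zero_lt := by decide +kernel
  head_lt := by decide +kernel
  exists_head n hn := by
    obtain ⟨m, rfl⟩ := Nat.exists_eq_succ_of_ne_zero hn
    refine ⟨4, le_rfl, ?_⟩
    rw [show b1.take 41 ++ [4] = b1.take 42 by decide +kernel]
    exact (b1_isPrefix_alpha m).1
  exists_last n hn := by
    obtain ⟨m, rfl⟩ := Nat.exists_eq_succ_of_ne_zero hn
    exact ⟨m + 4, by omega, getLast?_alpha m⟩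
  ne_nil n := by
    rcases n with _ | n
    · intro h
      have := getLast?_f
      rw [content] at h
      rw [h] at this
      simp at this
    · exact alpha_ne_nil _
  prefix_free := content_prefix_free
  last_inj m n h := by
    rcases m with _ | m <;> rcases n with _ | n <;>
      simp only [content, getLast?_alpha, getLast?_f, Option.some.injEq] at h ⊢ <;> omega
  sqFree := sqFree_of_sqFreeTest (by decide +kernel)
  eq_of_prefix_drop g hg := by
    have := eq_of_occursTest (m := (e ++ content 0).length) (g := 0) (by simp [e])
      (by decide +kernel) hg
    simpa using this
  mark_ne_nil := by simp
  not_isInfix_mark n hn := by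
    obtain ⟨m, rfl⟩ := Nat.exists_eq_succ_of_ne_zero hn
    obtain ⟨x, -, hx⟩ := exists_mapList_rho m
    rw [content, hx]
    exact not_isInfix_mapList_rho x
  mark_left := by decide +kernel
  mark_right := by decide +kernel
  le_length := by decide +kernel

theorem not_isSq_cat_content {u : ℕ → ℕ} (hu : ∀ k, u k = 0 ↔ Even k)
    (hsq : ∀ i p, ¬ IsSq u i p) (i p : ℕ) : ¬ IsSq (cat (fun n => e ++ content n) u) i p := by
  intro hs
  rcases separated_content.isSq_cases hu hs with ⟨k, t, ht, -⟩ | ⟨k, hk, h1, h2⟩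
  · exact hsq k t ht
  · have hk0 : u k ≠ 0 := by rw [Ne, hu]; simpa using hk
    have he : e.length = 1592 := by decide +kernel
    have h3 := (separated_content.occursAt_sep (u := u) k).drop (o := 1591) (by omega)
    have h4 := separated_content.occursAt_content (u := u) k
    have h5 := (separated_content.occursAt_sep (u := u) (k + 1)).of_isPrefix
      (x := [0, 1, 0, 2, 0, 3, 0, 1]) (by decide +kernel)
    rw [show e.drop 1591 = [2] by decide +kernel] at h3
    rw [Separated.pos_succ'] at h2 h5
    rw [he] at h1 h2 h4 h5
    obtain ⟨n, hn⟩ := Nat.exists_eq_succ_of_ne_zero hk0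
    rw [hn] at h2 h4 h5
    change OccursAt (alpha (n + 1)) _ _ at h4
    change i + 2 * p < _ + (alpha (n + 1)).length + 7 + 2 at h2
    change OccursAt _ _ (_ + (alpha (n + 1)).length) at h5
    have h6 := occursAt_append.mpr ⟨occursAt_append.mpr ⟨h3, h4⟩, by
      rwa [List.length_append, List.length_singleton, ← Nat.add_assoc]⟩
    have h7 := (sqFree_alpha n).not_isSq h6 hs (by omega)
    simp only [List.length_append, List.length_cons, List.length_nil] at h7
    omega

theorem alpha_zero : alpha 0 = e ++ f ++ e := by rw [alpha, E_eq, F_eq]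

theorem mapList_alpha_takeInf {u : ℕ → ℕ} (hu : ∀ k, u k = 0 ↔ Even k) (m : ℕ) :
    mapList alpha (takeInf u (2 * m)) = mapList (fun n => e ++ content n) (takeInf u (2 * m)) := by
  induction m with
  | zero => rfl
  | succ m ih =>
    rw [Nat.mul_add, Nat.mul_one, mapList_takeInf_succ, mapList_takeInf_succ,
      mapList_takeInf_succ, mapList_takeInf_succ, ih, (hu (2 * m)).mpr (by simp)]
    obtain ⟨n, hn⟩ := Nat.exists_eq_succ_of_ne_zero (n := u (2 * m + 1)) (by rw [Ne, hu]; simp)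
    rw [hn, alpha_zero]
    simp only [content, List.append_assoc, Nat.succ_eq_add_one]

/-- The product of the images `alpha (u k)` is the product of the words `E` and `content (u k)`,
since `alpha 0 = E F E`. -/
theorem cat_alpha {u : ℕ → ℕ} (hu : ∀ k, u k = 0 ↔ Even k) :
    cat alpha u = cat (fun n => e ++ content n) u := by
  funext i
  have h1 := takeInf_cat alpha_ne_nil u (2 * (i + 1))
  have h2 := takeInf_cat (b := fun n => e ++ content n) separated_content.block_ne_nil u
    (2 * (i + 1))
  rw [← mapList_alpha_takeInf hu, ← h1] at h2
  have hi : i < pos alpha u (2 * (i + 1)) := by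
    have := (pos_strictMono alpha_ne_nil u).le_apply (x := 2 * (i + 1))
    omega
  have hl := congrArg List.length h2
  rw [length_takeInf, length_takeInf] at hl
  have h3 := getElem_takeInf (cat alpha u) (pos alpha u (2 * (i + 1))) i (by simpa using hi)
  rw [← h3]
  simp only [← h2]
  rw [getElem_takeInf]

theorem not_isSq_cat_alpha {u : ℕ → ℕ} (hu : ∀ k, u k = 0 ↔ Even k)
    (hsq : ∀ i p, ¬ IsSq u i p) (i p : ℕ) : ¬ IsSq (cat alpha u) i p := by
  rw [cat_alpha hu]
  exact not_isSq_cat_content hu hsq i p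

/-! ### Greedy minimality of the images -/

/-- All letters of `alpha 0` and of a following `B1` are forced by what precedes them, apart from the
first nine letters. The list `P` consists of the half-lengths of the shortest squares completed by
smaller letters. -/
theorem forced_drop_nine : Forced G ((e ++ f ++ e).drop 9 ++ b1) :=
  forced_of_forcedTest (v := [2, 1, 0, 3, 0, 2, 0, 1, 0])
    (P := [1, 2, 3, 4, 6, 8, 12, 13, 16, 26, 31, 34, 52, 62, 68, 255, 261, 510, 522, 799, 1634])
    (by decide +kernel)

theorem G_append_drop_nine : G ++ (e ++ f ++ e).drop 9 = e ++ f ++ e := by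
  rw [show G = (e ++ f ++ e).take 9 by decide +kernel, List.take_append_drop]

theorem forced_b1_of_zero (w : List ℕ) : Forced (w ++ (e ++ f ++ e)) b1 := by
  have h := (forced_append.mp forced_drop_nine).2
  rw [G_append_drop_nine] at h
  exact h.append_left w

/-- After a piece `q j`, the letter `1` in place of the first `3` of `C` completes a square with
period the length of `R (j + 4)`. -/
theorem blocked_one (Y : List ℕ) (j : ℕ) : Blocked (Y ++ b1 ++ q j ++ [0, 1, 0, 2, 0]) 1 := by
  have hb : b1 = b1.take 1562 ++ (R 4).drop 6 := by decide +kernel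
  have hq := length_q j
  have h2 : 2 ^ (j + 5) = 2 * 2 ^ (j + 4) := pow_succ' 2 (j + 4)
  have h : (R 4).drop 6 ++ q j ++ [0, 1, 0, 2, 0] ++ [1] =
      capWord (j + 4) 7 (2 ^ (j + 4)) ++ capWord (j + 4) 7 (2 ^ (j + 4)) := by
    have h1 := drop_append_q_append_take j 6 (by omega)
    rw [show 10 + (q j).length + 6 = 2 ^ (j + 4) + 2 ^ (j + 4) by omega, capWord_add,
      show 7 + 2 ^ (j + 4) = 1 * 2 ^ (j + 4) + 7 by omega, capWord_add_mul _ _ _ (by omega)] at h1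
    rw [← h1, List.append_assoc _ [0, 1, 0, 2, 0]]
    rfl
  rw [hb]
  have : Blocked ((R 4).drop 6 ++ q j ++ [0, 1, 0, 2, 0]) 1 := by
    refine ⟨capWord (j + 4) 7 (2 ^ (j + 4)), ?_, by rw [h]⟩
    rw [← List.length_pos_iff, length_capWord]
    positivity
  simpa only [List.append_assoc] using this.append_left (Y ++ b1.take 1562)

/-- The beginning of `C` and of `E` is forced after `B1` and a piece. -/
theorem forced_after_q (Y : List ℕ) (j : ℕ) : Forced (Y ++ b1 ++ q j) [0, 1, 0, 2, 0, 3] := by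
  rw [show [0, 1, 0, 2, 0, 3] = [0, 1, 0, 2, 0] ++ [3] from rfl, forced_append, forced_singleton]
  refine ⟨Forced.of_nil (forced_of_forcedTest (v := []) (P := [1, 2]) (by decide +kernel)) _,
    fun c hc => ?_⟩
  interval_cases c
  · exact (blocked_of_blockedTest (v := [0, 2, 0, 1, 0]) (P := [1])
      (by decide +kernel)).append_left _
  · exact blocked_one Y j
  · exact (blocked_of_blockedTest (v := [0, 2, 0, 1, 0]) (P := [2])
      (by decide +kernel)).append_left _

theorem forced_C_append_b1 (Y : List ℕ) (j : ℕ) : Forced (Y ++ b1 ++ q j) (C ++ b1) := by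
  rw [show C ++ b1 = [0, 1, 0, 2, 0, 3] ++ (C ++ b1).drop 6 by decide +kernel, forced_append]
  exact ⟨forced_after_q Y j, (forced_of_forcedTest (v := [3, 0, 2, 0, 1, 0])
    (P := [1, 2, 3, 4, 6, 8, 12, 16, 26, 52, 62, 68, 510, 522]) (by decide +kernel)).append_left _⟩

theorem forced_plus_alpha {w : List ℕ} {n : ℕ} (h : Forced w (alpha (n + 1)))
    (hb : Blocked (w ++ (alpha (n + 1)).dropLast) (n + 4)) : Forced w (plus (alpha (n + 1))) := by
  rw [alpha_eq_dropLast_append, forced_append, forced_singleton] at h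
  rw [alpha_eq_dropLast_append, plus_concat, forced_append, forced_singleton]
  refine ⟨h.1, fun c hc => ?_⟩
  rcases Nat.lt_or_eq_of_le (Nat.le_of_lt_succ hc) with h1 | rfl
  · exact h.2 c h1
  · exact hb

/-- After `C`, the word `alpha (m + 1)` completes the square `C ++ alpha (m + 1)`. -/
theorem blocked_after_C (w : List ℕ) (m : ℕ) :
    Blocked (w ++ C ++ (alpha (m + 1)).dropLast) (m + 4) := by
  refine ⟨mapList block (R m), ?_, w, ?_⟩
  · intro h
    rw [R_eq_dropLast_append, mapList_append, mapList_singleton] at h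
    exact block_ne_nil _ (List.append_eq_nil_iff.mp h).2
  · rw [← mapList_append, ← C_append_alpha]
    conv_lhs => rw [alpha_eq_dropLast_append]
    simp only [List.append_assoc]

/-- The image of a nonzero letter `n + 1` is forced wherever `b1` is forced, provided that the
images of the smaller nonzero letters would complete squares there. -/
theorem forced_alpha (n : ℕ) (w : List ℕ) (hw : Forced w b1)
    (hb : ∀ m < n, Blocked (w ++ (alpha (m + 1)).dropLast) (m + 4)) :
    Forced w (alpha (n + 1)) := by
  induction n generalizing w with
  | zero =>
    have h := forced_append.mp (forced_C_append_b1 w 0)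
    rw [q_zero] at h
    rw [alpha, B1_eq]
    simp only [forced_append]
    refine ⟨⟨⟨⟨hw, forced_R _ _⟩, ?_⟩, ?_⟩, forced_R _ _⟩
    · simpa only [List.append_assoc] using h.1
    · simpa only [List.append_assoc] using h.2
  | succ n ih =>
    obtain ⟨Y, hY⟩ := exists_alpha_eq n
    have hq : plus (alpha (n + 1)) ++ R (n + 5) = Y ++ b1 ++ q (n + 1) := by
      rw [hY, plus_append (q_ne_nil n), q_succ, List.append_assoc (Y ++ b1)]
    have h := forced_append.mp (forced_C_append_b1 (w ++ Y) (n + 1))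
    rw [show w ++ Y ++ b1 ++ q (n + 1) = w ++ (Y ++ b1 ++ q (n + 1)) by
      simp only [List.append_assoc], ← hq] at h
    have h1 := forced_plus_alpha (ih w hw fun m hm => hb m (by omega)) (hb n (by omega))
    have h2 := forced_plus_alpha (ih _ h.2 fun m _ => blocked_after_C _ m) (blocked_after_C _ n)
    rw [alpha]
    simp only [forced_append]
    refine ⟨⟨⟨⟨h1, forced_R _ _⟩, ?_⟩, ?_⟩, forced_R _ _⟩
    · simpa only [List.append_assoc] using h.1
    · simpa only [List.append_assoc] using h2

theorem exists_alpha_eq_append_C (n : ℕ) : ∃ A, alpha (n + 1) = A ++ C ++ A := by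
  rcases n with _ | n
  · exact ⟨b1 ++ R 4, by rw [alpha, B1_eq]; simp only [List.append_assoc]⟩
  · exact ⟨plus (alpha (n + 1)) ++ R (n + 5), by rw [alpha]; simp only [List.append_assoc]⟩

/-- With `alpha (n + 1) = A C A`, and a letter `2` before it, the letter `0` after `01020301`
completes a square with period the length of `A C`. -/
theorem blocked_zero (w : List ℕ) (n : ℕ) :
    Blocked (w ++ [2] ++ alpha (n + 1) ++ [0, 1, 0, 2, 0, 3, 0, 1]) 0 := by
  obtain ⟨A, hA⟩ := exists_alpha_eq_append_C n
  refine ⟨[2] ++ A ++ [0, 1, 0, 2, 0, 3, 0, 1, 0], by simp, w, ?_⟩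
  rw [hA, show C = [0, 1, 0, 2, 0, 3, 0, 1, 0] ++ [2] from rfl]
  simp only [List.append_assoc]
  rfl

/-- After the image of a nonzero letter, `alpha 0` is forced. Only for the first `3` (to exclude `1`)
and for the `2` three places later (to exclude `0`) does this depend on the letters before
`alpha 0`. -/
theorem forced_alpha_zero (w : List ℕ) (n : ℕ) :
    Forced (w ++ (e ++ f ++ e) ++ alpha (n + 1)) (e ++ f ++ e) := by
  have he : e ++ f ++ e = (e ++ f ++ e).dropLast ++ [2] := by decide +kernel
  have hG : e ++ f ++ e = [0, 1, 0, 2, 0, 3] ++ [0, 1] ++ [2] ++ (e ++ f ++ e).drop 9 :=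
    G_append_drop_nine.symm
  have h9 := (forced_append.mp forced_drop_nine).1
  generalize (e ++ f ++ e).drop 9 = z at hG h9
  generalize (e ++ f ++ e).dropLast = x at he
  have h0 : Forced (w ++ (e ++ f ++ e) ++ alpha (n + 1)) [0, 1, 0, 2, 0, 3] := by
    obtain ⟨Y, hY⟩ := exists_alpha_eq n
    have := forced_after_q (w ++ (e ++ f ++ e) ++ Y) n
    rw [hY]
    simpa only [List.append_assoc] using this
  conv => arg 2; rw [hG]
  rw [he] at h0 ⊢
  simp only [forced_append, forced_singleton]
  refine ⟨⟨⟨h0, ?_⟩, fun c hc => ?_⟩, ?_⟩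
  · exact (forced_of_forcedTest (v := [3, 0, 2, 0, 1, 0]) (P := [1])
      (by decide +kernel)).append_left _
  · interval_cases c
    · have := blocked_zero (w ++ x) n
      rw [show [0, 1, 0, 2, 0, 3, 0, 1] = [0, 1, 0, 2, 0, 3] ++ [0, 1] from rfl] at this
      simpa only [List.append_assoc] using this
    · exact (blocked_of_blockedTest (c := 1) (v := [1, 0, 3, 0, 2, 0, 1, 0]) (P := [1]) (by decide +kernel)).append_left _
  · have := h9.append_left (w ++ (x ++ [2]) ++ alpha (n + 1))
    rw [show G = [0, 1, 0, 2, 0, 3] ++ [0, 1] ++ [2] from rfl] at this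
    simpa only [List.append_assoc] using this

/-! ### Least completions of even-grounded words and of their images -/

theorem L_nil : L (fin []) = L (fin [0]) :=
  L_eq_L_append (z := [0]) (sqFree_of_sqFreeTest (by decide +kernel))
    (forced_singleton.mpr fun c hc => absurd hc (Nat.not_lt_zero c))

theorem L_G : L (fin G) = L (fin (alpha 0)) := by
  rw [alpha_zero, ← G_append_drop_nine]
  refine L_eq_L_append ?_ (forced_append.mp forced_drop_nine).1
  rw [G_append_drop_nine]
  exact separated_content.sqFree.of_isPrefix (List.prefix_append _ _)

theorem IsLeastCompletion.not_isSq {w : List ℕ} {u : ℕ → ℕ} (h : IsLeastCompletion w u)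
    (hsq : (fin w).SquareFree) (i p : ℕ) : ¬ IsSq u i p := by
  intro hs
  have hle := (isCompletion_iff.mp h.1).2 i p hs
  obtain ⟨y, hy, hl, ho⟩ := hs.exists_occursAt
  refine hsq y i hy fun j hj => ?_
  have hw := h.1.1 (i + j) (by rw [List.length_append] at hj; omega)
  rw [Nat.zero_add] at hw
  rw [← ho j hj, hw]
  rfl

/-- The least completion of a word from `SigmaWords` is even-grounded. At an even place, a square
completed by `0` has even period, and shifting it by one letter to the left gives an earlier
square. -/
theorem IsLeastCompletion.eq_zero_iff {w : List ℕ} {u : ℕ → ℕ} (h : IsLeastCompletion w u)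
    (hw : fin w ∈ SigmaWords) (k : ℕ) : u k = 0 ↔ Even k := by
  obtain ⟨hne, hev, hsq⟩ := hw
  have hpos : 0 < w.length := by
    rw [List.length_pos_iff]
    rintro rfl
    exact hne rfl
  have hns := h.not_isSq hsq
  have hgreedy := (isLeastCompletion_iff.mp h).2
  induction k using Nat.strong_induction_on with
  | _ k ih =>
    rcases Nat.lt_or_ge k w.length with hk | hk
    · have h1 := h.1.1 k hk
      rw [Nat.zero_add] at h1
      have h2 := hev k (u k) h1.symm
      rcases Nat.even_or_odd k with h3 | h3
      · exact ⟨fun _ => h3, fun _ => h2.1 h3⟩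
      · exact ⟨fun h4 => absurd h4 (h2.2 h3), fun h4 => absurd h4 (Nat.not_even_iff_odd.mpr h3)⟩
    · rcases Nat.even_or_odd k with hk2 | hk2
      · refine ⟨fun _ => hk2, fun _ => ?_⟩
        by_contra hu
        have hb := hgreedy k hk 0 (by omega)
        let t := Function.update u k 0
        have ht : ∀ j < k, t j = u j := fun j hj => Function.update_of_ne (by omega) _ _
        have htk : t k = 0 := Function.update_self _ _ _
        rw [← takeInf_congr ht, ← htk, blocked_takeInf_iff] at hb
        obtain ⟨i, p, hs, hip⟩ := hb
        have hp := hs.1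
        have hik : i ≤ k - 1 ∧ i % 2 = 1 := by rw [Nat.even_iff] at hk2; omega
        have hzero : ∀ j, j ≤ k → (t j = 0 ↔ Even j) := by
          intro j hj
          rcases Nat.lt_or_eq_of_le hj with h1 | rfl
          · rw [ht j h1]; exact ih j h1
          · simp [htk, hk2]
        have h0 := hs.2 0 hp
        rw [Nat.add_zero, Nat.add_zero] at h0
        have h1 : Even i ↔ Even (i + p) := by
          rw [← hzero i (by omega), ← hzero (i + p) (by omega), h0]
        rw [Nat.even_iff, Nat.even_iff] at h1
        refine hns (i - 1) p ⟨hp, fun a ha => ?_⟩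
        rcases Nat.eq_zero_or_pos a with rfl | ha0
        · have h2 := (ih (i - 1) (by omega)).mpr (by rw [Nat.even_iff]; omega)
          have h3 := (ih (i - 1 + p) (by omega)).mpr (by rw [Nat.even_iff]; omega)
          rw [Nat.add_zero, Nat.add_zero, h2, h3]
        · have h2 := hs.2 (a - 1) (by omega)
          rw [ht _ (by omega), ht _ (by omega)] at h2
          rw [show i - 1 + a = i + (a - 1) by omega, show i - 1 + p + a = i + p + (a - 1) by omega,
            h2]
      · refine ⟨fun hu => ?_, fun h1 => absurd h1 (Nat.not_even_iff_odd.mpr hk2)⟩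
        exfalso
        have hk3 := hk2.pos
        have h1 := (ih (k - 1) (by omega)).mpr (by rw [Nat.even_iff]; rw [Nat.odd_iff] at hk2; omega)
        refine hns (k - 1) 1 ⟨Nat.one_pos, fun a ha => ?_⟩
        rw [show k - 1 + a = k - 1 by omega, show k - 1 + 1 + a = k by omega, h1, hu]

/-- If a letter is forced after a word, then its image is forced after the image of the word. -/
theorem forced_alpha_of_greedy {u : ℕ → ℕ} (hu : ∀ k, u k = 0 ↔ Even k) {K : ℕ} (hK : 0 < K)
    (hgreedy : ∀ c < u K, Blocked (takeInf u K) c) :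
    Forced (mapList alpha (takeInf u K)) (alpha (u K)) := by
  rcases Nat.even_or_odd K with hK2 | hK2
  · obtain ⟨k, rfl⟩ : ∃ k, K = k + 2 := ⟨K - 2, by rw [Nat.even_iff] at hK2; omega⟩
    obtain ⟨n, hn⟩ := Nat.exists_eq_succ_of_ne_zero (n := u (k + 1)) (by
      rw [Ne, hu, Nat.even_iff]; rw [Nat.even_iff] at hK2; omega)
    have h0 : u k = 0 := (hu k).mpr (by rw [Nat.even_iff] at hK2 ⊢; omega)
    rw [mapList_takeInf_succ, mapList_takeInf_succ, hn, h0, (hu (k + 2)).mpr hK2, alpha_zero]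
    exact forced_alpha_zero _ n
  · obtain ⟨k, rfl⟩ : ∃ k, K = k + 1 := ⟨K - 1, by omega⟩
    obtain ⟨n, hn⟩ := Nat.exists_eq_succ_of_ne_zero (n := u (k + 1)) (by
      rw [Ne, hu]; exact Nat.not_even_iff_odd.mpr hK2)
    have h0 : u k = 0 := (hu k).mpr (by simpa [Nat.odd_add_one] using hK2)
    rw [hn] at hgreedy ⊢
    refine forced_alpha n _ ?_ fun m hm => ?_
    · rw [mapList_takeInf_succ, h0, alpha_zero]
      exact forced_b1_of_zero _
    · obtain ⟨y, hy, z, hz⟩ := hgreedy (m + 1) (by omega)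
      refine ⟨mapList alpha y, ?_, mapList alpha z, ?_⟩
      · obtain ⟨a, y, rfl⟩ := List.exists_cons_of_ne_nil hy
        exact fun h => alpha_ne_nil a (List.append_eq_nil_iff.mp h).1
      · rw [← mapList_append, ← mapList_append, hz, mapList_append, mapList_singleton,
          List.append_assoc, ← alpha_eq_dropLast_append]

/-- For `u` with `L w = u`, the product of the images of the letters of `u` has no squares, and from
the end of the image of `w` on all its letters are forced. -/
theorem lCommuting_alpha : LCommuting alpha SigmaWords := by
  rintro (w | s) hw
  · obtain ⟨u, hu, hL⟩ := exists_L_eq w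
    have hz := hu.eq_zero_iff hw
    have hsq := not_isSq_cat_alpha hz (hu.not_isSq hw.2.2)
    rw [hL, applyMorphism_inf alpha_ne_nil]
    change L (fin (mapList alpha w)) = _
    refine IsLeastCompletion.L_eq ?_
    have hpos : 0 < w.length := by
      rw [List.length_pos_iff]
      rintro rfl
      exact hw.1 rfl
    have hgreedy := (isLeastCompletion_iff.mp hu).2
    have hwu := (isCompletion_iff.mp hu.1).1
    have hlen : (mapList alpha w).length = pos alpha u w.length := by rw [pos, hwu]
    rw [isLeastCompletion_iff, isCompletion_iff]
    refine ⟨⟨?_, fun i p h => absurd h (hsq i p)⟩, fun j hj c hc => ?_⟩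
    · rw [hlen, takeInf_cat alpha_ne_nil, hwu]
    · obtain ⟨K, hK1, hK2⟩ := exists_pos_le_lt alpha_ne_nil u j
      have hmono := pos_strictMono alpha_ne_nil u
      have hK : w.length < K + 1 := hmono.lt_iff_lt.mp (by omega)
      obtain ⟨o, rfl⟩ := Nat.exists_eq_add_of_le hK1
      rw [pos_succ] at hK2
      have h1 := forced_alpha_of_greedy hz (by omega) (hgreedy K (by omega)) o (by omega) c (by
        rwa [← occursAt_inf_iff.mp (occursAt_cat alpha_ne_nil u K) o (by omega)])
      have h2 := occursAt_takeInf (cat alpha u) (pos alpha u (K + 1))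
      rw [takeInf_cat alpha_ne_nil, mapList_takeInf_succ] at h2
      rwa [takeInf_eq_take h2 (by rw [List.length_append, ← pos]; omega), pos,
        List.take_length_add_append]
  · rw [L, applyMorphism_inf alpha_ne_nil, L]

end LexSquareFree

theorem mainTheorem3 :
    LexSquareFree.LCommuting LexSquareFree.alpha LexSquareFree.SigmaWords ∧
    LexSquareFree.L (LexSquareFree.Word.fin LexSquareFree.G) =
      LexSquareFree.L (LexSquareFree.Word.fin (LexSquareFree.alpha 0)) ∧
    LexSquareFree.L (LexSquareFree.Word.fin (LexSquareFree.alpha 0)) =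
      LexSquareFree.applyMorphism LexSquareFree.alpha
        (LexSquareFree.L (LexSquareFree.Word.fin [])) := by
  refine ⟨LexSquareFree.lCommuting_alpha, LexSquareFree.L_G, ?_⟩
  have h := LexSquareFree.lCommuting_alpha (LexSquareFree.Word.fin [0]) ⟨by simp, ?_, ?_⟩
  · rw [LexSquareFree.L_nil, ← h, LexSquareFree.applyMorphism, LexSquareFree.mapList_singleton]
  · rintro (_ | i) a ha
    · simp only [LexSquareFree.Word.get?, List.getElem?_cons_zero, Option.some.injEq] at ha
      subst ha
      simp
    · simp [LexSquareFree.Word.get?] at ha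
  · intro y i hy ho
    have h1 := List.length_pos_iff.mpr hy
    have h2 := ho y.length (by simp; omega)
    simp [LexSquareFree.Word.get?, hy] at h2
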